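/- **Setting.** Let $x_{k+1}=Ax_k+w_k$ $(k\ge 0)$ with $x_k\in\mathbb R^n$, observed by nodes $i=1,\dots,N$ through $y_{i,k}=C_ix_k+v_{i,k}$ $(k\ge1)$, where $x_0\sim\mathbf N(\hat x_0,P_0)$, $w_k\sim\mathbf N(0,Q)$, $v_{i,k}\sim\mathbf N(0,R_i)$ with $P_0,Q,R_i>0$, and $x_0-\hat x_0$, the $w_k$ and the $v_{i,k}$ are mutually uncorrelated, across all times and nodes (for instance, mutually independent). The nodes form a connected undirected graph with a doubly stochastic weight matrix $\mathcal L=[l_{ij}]$ such that $l_{ii}>0$ and, for $i\ne j$, $l_{ij}>0$ if and only if $\{i,j\}$ is an edge. Let $\gamma\ge1$ be the number of consensus steps per sampling instant, where one consensus step replaces $(Z_i)_i$ by $(\sum_j l_{ij}Z_j)_i$, and let $l^{(\gamma)}_{ij}$ be the entries of $\mathcal L^\gamma$. Suppose that $(A,\operatorname{col}_i(C_i))$ is observable, and put $$\tilde C_i=\sum_{j}l_{ij}^{(\gamma)}C_j^TR_j^{-1}C_j,\qquad \tilde R_i=\sum_{j}(l_{ij}^{(\gamma)})^2C_j^TR_j^{-1}C_j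 .$$ Let $Y_i\in\mathbb R^{n\times n}$ satisfy $Y_i^TY_i=C_i^TR_i^{-1}C_i$, and let $\dagger$ denote the Moore–Penrose inverse. **Algorithms.** Given estimates $U_{i,k}$ of $\tilde R_i$ $(k\ge1)$, node $i$ starts from $\hat x_{i,0|0}=\hat x_0$, $P_{i,0|0}=P_0$ and computes for $k\ge1$ $$\hat x_{i,k|k-1}=A\hat x_{i,k-1|k-1},\qquad P_{i,k|k-1}=AP_{i,k-1|k-1}A^T+Q,$$ $$P_{i,k|k}=(P_{i,k|k-1}^{-1}+\tilde C_i^TU_{i,k}^\dagger\tilde C_i)^{-1},\qquad \hat x_{i,k|k}=P_{i,k|k}(P_{i,k|k-1}^{-1}\hat x_{i,k|k-1}+\tilde C_i^TU_{i,k}^\dagger\tilde y_{i,k}),$$ where $\tilde y_{i,k}$ results from $\gamma$ consensus steps started from $C_i^TR_i^{-1}y_{i,k}$. * Algorithm 1 (direct method): each node has a row vector $q_i\in\mathbb R^{1\times N}$, and $U_{i,k}=\tilde u_i(\tilde W_{i,k}\otimes I_n)^\dagger\tilde u_i^T$, where $\tilde u_i$ results from $\gamma$ consensus steps started from $Y_i^T(q_i\otimes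 I_n)$, $\tilde W_{i,0}=Nq_i^Tq_i$, and $(\tilde W_{i,k})_i$ results from $\gamma$ consensus steps started from $(\tilde W_{i,k-1})_i$. The entries of the $q_i$ are sampled independently from $\mathbf N(0,1)$. * Algorithm 2 (stochastic method): $U_{i,0}=0$ and $U_{i,k}=\frac{k-1}kU_{i,k-1}+\frac1k\tilde\upsilon_{i,k}\tilde\upsilon_{i,k}^T$ for $k\ge1$, where $\tilde\upsilon_{i,k}$ results from $\gamma$ consensus steps started from $Y_i^T\theta_{i,k}$, and the $\theta_{i,k}$ $(k\ge1)$ are sampled independently from $\mathbf N(0,I_n)$. Let $\tilde P_{i,k+1|k}=\mathbb E[(x_{k+1}-\hat x_{i,k+1|k})(x_{k+1}-\hat x_{i,k+1|k})^T]$ be the true prior error covariance. The expectation is over $x_0$, the $w$'s and the $v$'s only, for given samples $q_i$ or $\theta_{i,k}$. **Theorem.** If $(A,\tilde C_i)$ is observable for every $i$, then for every $i$ the Riccati equation $$P_i=A\,(P_i^{-1}+\tilde C_i^T\tilde R_i^\dagger\tilde C_i)^{-1}A^T+Q$$ has exactly one positive definite solution $P_i$, the prior errors in the following are square integrable, and,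 as $k\to\infty$: 1. in Algorithm 1, $\tilde P_{i,k+1|k}\to P_i$ for every choice of the $q_i$ for which the matrix with rows $q_1,\dots,q_N$ has full rank, and hence for almost every sample of the $q_i$; 2. in Algorithm 2, $\tilde P_{i,k+1|k}\to P_i$ almost surely with respect to the samples $\theta_{i,k}$. -/

import Mathlib

open MeasureTheory ProbabilityTheory Filter Topology Matrix
open scoped Kronecker

noncomputable section

/-! ### The Moore-Penrose inverse of a real matrix -/

section MoorePenrose

variable {ι κ : Type*} [Fintype ι] [Fintype κ]

/-- The four Penrose equations: `X` is the Moore-Penrose inverse of `M`. -/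
structure IsMoorePenrose (M : Matrix ι κ ℝ) (X : Matrix κ ι ℝ) : Prop where
  mul_mul_self : M * X * M = M
  mul_mul_inv : X * M * X = X
  symm_left : (M * X)ᵀ = M * X
  symm_right : (X * M)ᵀ = X * M

theorem IsMoorePenrose.unique {M : Matrix ι κ ℝ} {X Y : Matrix κ ι ℝ}
    (hX : IsMoorePenrose M X) (hY : IsMoorePenrose M Y) : X = Y := by
  have h1 : M * X = M * Y := by
    calc M * X = (M * X)ᵀ := hX.symm_left.symm
      _ = ((M * Y) * (M * X))ᵀ := by
          rw [← Matrix.mul_assoc, hY.mul_mul_self]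
      _ = (M * X) * (M * Y) := by
          rw [Matrix.transpose_mul, hX.symm_left, hY.symm_left]
      _ = M * Y := by rw [← Matrix.mul_assoc, hX.mul_mul_self]
  have h2 : X * M = Y * M := by
    calc X * M = (X * M)ᵀ := hX.symm_right.symm
      _ = ((X * M) * (Y * M))ᵀ := by
          rw [Matrix.mul_assoc, ← Matrix.mul_assoc M, hY.mul_mul_self]
      _ = (Y * M) * (X * M) := by
          rw [Matrix.transpose_mul, hX.symm_right, hY.symm_right]
      _ = Y * M := by rw [Matrix.mul_assoc, ← Matrix.mul_assoc M, hX.mul_mul_self]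
  calc X = X * M * X := hX.mul_mul_inv.symm
    _ = Y * (M * X) := by rw [h2, Matrix.mul_assoc]
    _ = Y := by rw [h1, ← Matrix.mul_assoc, hY.mul_mul_inv]

theorem exists_isMoorePenrose_of_isSymm {B : Matrix κ κ ℝ} (hB : Bᵀ = B) :
    ∃ X : Matrix κ κ ℝ, IsMoorePenrose B X ∧ Xᵀ = X := by
  classical
  have hH : B.IsHermitian := by
    rw [Matrix.IsHermitian, Matrix.conjTranspose_eq_transpose_of_trivial, hB]
  obtain ⟨V, d, hV, hV', hd⟩ : ∃ (V : Matrix κ κ ℝ) (d : κ → ℝ),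
      Vᵀ * V = 1 ∧ V * Vᵀ = 1 ∧ B = V * Matrix.diagonal d * Vᵀ := by
    refine ⟨hH.eigenvectorUnitary, hH.eigenvalues, ?_, ?_, ?_⟩
    · have := Unitary.coe_star_mul_self hH.eigenvectorUnitary
      rwa [Matrix.star_eq_conjTranspose,
        Matrix.conjTranspose_eq_transpose_of_trivial] at this
    · have := Unitary.coe_mul_star_self hH.eigenvectorUnitary
      rwa [Unitary.coe_star, Matrix.star_eq_conjTranspose,
        Matrix.conjTranspose_eq_transpose_of_trivial] at this
    · have := hH.spectral_theorem
      rw [Unitary.conjStarAlgAut_apply, Matrix.star_eq_conjTranspose,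
        Matrix.conjTranspose_eq_transpose_of_trivial] at this
      simpa [Function.comp_def] using this
  have key : ∀ e f : κ → ℝ, (V * Matrix.diagonal e * Vᵀ) * (V * Matrix.diagonal f * Vᵀ)
      = V * Matrix.diagonal (fun i => e i * f i) * Vᵀ := by
    intro e f
    calc (V * Matrix.diagonal e * Vᵀ) * (V * Matrix.diagonal f * Vᵀ)
        = V * Matrix.diagonal e * (Vᵀ * V) * Matrix.diagonal f * Vᵀ := by
          simp only [Matrix.mul_assoc]
      _ = _ := by
          rw [hV, Matrix.mul_one, Matrix.mul_assoc V, Matrix.diagonal_mul_diagonal]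
  have hT : ∀ e : κ → ℝ, (V * Matrix.diagonal e * Vᵀ)ᵀ = V * Matrix.diagonal e * Vᵀ := by
    intro e
    simp [Matrix.transpose_mul, Matrix.mul_assoc]
  have hdd : ∀ x : ℝ, x * x⁻¹ * x = x := fun x => by
    by_cases h : x = 0 <;> simp [h]
  have hdi : ∀ x : ℝ, x⁻¹ * x * x⁻¹ = x⁻¹ := fun x => by
    by_cases h : x = 0 <;> simp [h]
  refine ⟨V * Matrix.diagonal (fun i => (d i)⁻¹) * Vᵀ, ⟨?_, ?_, ?_, ?_⟩, hT _⟩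
  · rw [hd, key, key]; simp only [hdd]
  · rw [hd, key, key]; simp only [hdi]
  · rw [hd, key, hT]
  · rw [hd, key, hT]

theorem exists_isMoorePenrose (M : Matrix ι κ ℝ) :
    ∃ X : Matrix κ ι ℝ, IsMoorePenrose M X := by
  classical
  obtain ⟨X, hX, hXs⟩ := exists_isMoorePenrose_of_isSymm (B := Mᵀ * M)
    (by rw [Matrix.transpose_mul, Matrix.transpose_transpose])
  have hM : M * X * (Mᵀ * M) = M := by
    have h0 : (M - M * X * (Mᵀ * M))ᵀ * (M - M * X * (Mᵀ * M)) = 0 := by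
      have h1 : Mᵀ * (M - M * X * (Mᵀ * M)) = 0 := by
        have h2 : Mᵀ * (M * X * (Mᵀ * M)) = Mᵀ * M := by
          rw [← hX.mul_mul_self]
          simp only [Matrix.mul_assoc]
          have := hX.mul_mul_self
          simp only [Matrix.mul_assoc] at this
          simp only [this]
        rw [Matrix.mul_sub, h2, sub_self]
      rw [Matrix.transpose_sub, Matrix.sub_mul, h1, Matrix.transpose_mul (M * X),
        Matrix.transpose_mul M X, Matrix.mul_assoc, Matrix.mul_assoc, h1]
      simp
    have h3 : M - M * X * (Mᵀ * M) = 0 := by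
      rw [← Matrix.conjTranspose_mul_self_eq_zero,
        Matrix.conjTranspose_eq_transpose_of_trivial]
      exact h0
    exact (sub_eq_zero.mp h3).symm
  refine ⟨X * Mᵀ, ?_, ?_, ?_, ?_⟩
  · simpa only [Matrix.mul_assoc] using hM
  · calc X * Mᵀ * M * (X * Mᵀ) = X * (Mᵀ * M) * X * Mᵀ := by simp only [Matrix.mul_assoc]
      _ = X * Mᵀ := by rw [hX.mul_mul_inv]
  · simp only [Matrix.transpose_mul, Matrix.transpose_transpose, hXs, Matrix.mul_assoc]
  · rw [Matrix.mul_assoc]; exact hX.symm_right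

/-- The Moore-Penrose inverse of a real matrix. -/
def pinv (M : Matrix ι κ ℝ) : Matrix κ ι ℝ := Classical.choose (exists_isMoorePenrose M)

theorem pinv_spec (M : Matrix ι κ ℝ) : IsMoorePenrose M (pinv M) :=
  Classical.choose_spec (exists_isMoorePenrose M)

end MoorePenrose

/-- Observability of the pair `(A, C)`: the observability matrix, which stacks
`C, C A, ..., C A ^ (n - 1)`, has trivial kernel (full column rank). -/
def Observable {n : ℕ} {ι : Type*} (A : Matrix (Fin n) (Fin n) ℝ) (C : Matrix ι (Fin n) ℝ) :
    Prop :=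
  ∀ x : Fin n → ℝ, (∀ k < n, (C * A ^ k) *ᵥ x = 0) → x = 0

/-- `X` is an `ℝᵈ`-valued random vector with the normal law `N(mean, S)`. -/
def IsNormalVector {Ω : Type*} [MeasurableSpace Ω] {d : ℕ} (X : Ω → Fin d → ℝ)
    (mean : Fin d → ℝ) (S : Matrix (Fin d) (Fin d) ℝ) (μ : Measure Ω) : Prop :=
  HasLaw (fun ω => WithLp.toLp 2 (X ω)) (multivariateGaussian (WithLp.toLp 2 mean) S) μ

/-- The matrix `𝔼[X Yᵀ]` of two random vectors. -/
def secondMoment {Ω : Type*} [MeasurableSpace Ω] {ι κ : Type*} (μ : Measure Ω)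
    (X : Ω → ι → ℝ) (Y : Ω → κ → ℝ) : Matrix ι κ ℝ :=
  Matrix.of fun a b => ∫ ω, X ω a * Y ω b ∂μ

/-! ### The sensor network and the linear system -/

/-- The data of a linear time-invariant system observed by `N` sensors: system matrix `A`,
process noise covariance `Q`, mean `xhat0` and covariance `P0` of the initial state, observation
matrix `C i`, noise covariance `R i` and output dimension `m i` of sensor `i`, consensus weights
`L`, number `γ` of consensus steps per sampling instant, and the square factors `Y i` of
`(C i)ᵀ (R i)⁻¹ (C i)` that the nodes choose. -/
structure SensorNetwork (N n : ℕ) where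
  A : Matrix (Fin n) (Fin n) ℝ
  Q : Matrix (Fin n) (Fin n) ℝ
  xhat0 : Fin n → ℝ
  P0 : Matrix (Fin n) (Fin n) ℝ
  m : Fin N → ℕ
  C : (i : Fin N) → Matrix (Fin (m i)) (Fin n) ℝ
  R : (i : Fin N) → Matrix (Fin (m i)) (Fin (m i)) ℝ
  L : Matrix (Fin N) (Fin N) ℝ
  γ : ℕ
  Y : Fin N → Matrix (Fin n) (Fin n) ℝ

namespace SensorNetwork

variable {N n : ℕ} (S : SensorNetwork N n)

/-- The stacked observation matrix `col (C i)`. -/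
def stackedC : Matrix (Σ i : Fin N, Fin (S.m i)) (Fin n) ℝ :=
  Matrix.of fun p b => S.C p.1 p.2 b

/-- The information matrix `(C i)ᵀ (R i)⁻¹ (C i)` of sensor `i`. -/
def info (i : Fin N) : Matrix (Fin n) (Fin n) ℝ := (S.C i)ᵀ * (S.R i)⁻¹ * S.C i

/-- The fused observation matrix `C̃ i`. -/
def fusedC (i : Fin N) : Matrix (Fin n) (Fin n) ℝ :=
  ∑ j, (S.L ^ S.γ) i j • S.info j

/-- The covariance matrix `R̃ i` of the fused measurement noise. -/
def fusedR (i : Fin N) : Matrix (Fin n) (Fin n) ℝ :=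
  ∑ j, ((S.L ^ S.γ) i j) ^ 2 • S.info j

/-- The standing assumptions: positive definite covariances; a connected undirected communication
graph; doubly stochastic weights that are positive exactly on the diagonal and on the edges;
collective observability; at least one consensus step; and `Y i` is a factor of the information
matrix of sensor `i`. -/
structure StandingAssumptions (G : SimpleGraph (Fin N)) : Prop where
  P0_pos : S.P0.PosDef
  Q_pos : S.Q.PosDef
  R_pos : ∀ i, (S.R i).PosDef
  connected : G.Connected
  doublyStochastic : S.L ∈ doublyStochastic ℝ (Fin N)
  self_weight_pos : ∀ i, 0 < S.L i i
  weight_pos_iff : ∀ i j, i ≠ j → (0 < S.L i j ↔ G.Adj i j)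
  observable : Observable S.A S.stackedC
  one_le_steps : 1 ≤ S.γ
  factor : ∀ i, S.info i = (S.Y i)ᵀ * S.Y i

/-- `P` is a (positive definite) solution of the discrete algebraic Riccati equation
`P = A (P⁻¹ + (C̃ i)ᵀ (R̃ i)† (C̃ i))⁻¹ Aᵀ + Q` of node `i`. -/
def SolvesDARE (i : Fin N) (P : Matrix (Fin n) (Fin n) ℝ) : Prop :=
  P.PosDef ∧
    P = S.A * (P⁻¹ + (S.fusedC i)ᵀ * pinv (S.fusedR i) * S.fusedC i)⁻¹ * S.Aᵀ + S.Q

section Noise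

variable {Ω : Type*} [MeasurableSpace Ω]

/-- The noise model: the initial state, the process disturbances `w k`, `k ≥ 0`, and the
measurement noises `v i t`, `t ≥ 1`, are normal, the disturbances and noises are white, and
initial state, disturbances and noises are mutually uncorrelated. -/
structure NoiseModel (μ : Measure Ω) (x0 : Ω → Fin n → ℝ) (w : ℕ → Ω → Fin n → ℝ)
    (v : (i : Fin N) → ℕ → Ω → Fin (S.m i) → ℝ) : Prop where
  law_x0 : IsNormalVector x0 S.xhat0 S.P0 μ
  law_w : ∀ k, IsNormalVector (w k) 0 S.Q μ
  law_v : ∀ i t, 1 ≤ t → IsNormalVector (v i t) 0 (S.R i) μ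
  w_white : ∀ k h, k ≠ h → secondMoment μ (w k) (w h) = 0
  v_white : ∀ i j s t, 1 ≤ s → 1 ≤ t → (i ≠ j ∨ s ≠ t) → secondMoment μ (v i s) (v j t) = 0
  w_v : ∀ k i t, 1 ≤ t → secondMoment μ (w k) (v i t) = 0
  x0_w : ∀ k, secondMoment μ (fun ω => x0 ω - S.xhat0) (w k) = 0
  x0_v : ∀ i t, 1 ≤ t → secondMoment μ (fun ω => x0 ω - S.xhat0) (v i t) = 0

end Noise

/-! ### Consensus and the two estimates of the fused noise covariance -/

/-- One consensus step `Z i ↦ ∑ j, l i j • Z j`. -/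
def consensusStep {V : Type*} [AddCommMonoid V] [Module ℝ V] (Z : Fin N → V) : Fin N → V :=
  fun i => ∑ j, S.L i j • Z j

/-- The `γ` consensus steps that are performed at each sampling instant. -/
def fuse {V : Type*} [AddCommMonoid V] [Module ℝ V] (Z : Fin N → V) : Fin N → V :=
  S.consensusStep^[S.γ] Z

/-- The row vector `q` times the identity: `q ⊗ Iₙ`, an `n × N n` matrix. -/
def rowKron (q : Fin N → ℝ) : Matrix (Fin n) (Fin N × Fin n) ℝ :=
  (Matrix.replicateRow Unit q ⊗ₖ (1 : Matrix (Fin n) (Fin n) ℝ)).submatrix (fun a => ((), a)) id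

/-- Direct method: the fused matrices `ũ i`, started from `(Y i)ᵀ (q i ⊗ Iₙ)`. -/
def directFactor (q : Fin N → Fin N → ℝ) : Fin N → Matrix (Fin n) (Fin N × Fin n) ℝ :=
  S.fuse fun i => (S.Y i)ᵀ * rowKron (q i)

/-- Direct method: the matrices `W̃ i` after the fusion at time `k`. They start from
`N (q i)ᵀ (q i)` at time `0`, and each fusion continues from the result of the previous one. -/
def directWeight (q : Fin N → Fin N → ℝ) : ℕ → Fin N → Matrix (Fin N) (Fin N) ℝ
  | 0 => fun i => (N : ℝ) • Matrix.vecMulVec (q i) (q i)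
  | k + 1 => S.fuse (directWeight q k)

/-- Direct method: the estimate `Ũ i k` of `R̃ i` at time `k ≥ 1`. -/
def directEstimate (q : Fin N → Fin N → ℝ) (k : ℕ) (i : Fin N) : Matrix (Fin n) (Fin n) ℝ :=
  S.directFactor q i *
    pinv (S.directWeight q k i ⊗ₖ (1 : Matrix (Fin n) (Fin n) ℝ)) * (S.directFactor q i)ᵀ

/-- Stochastic method: the fused samples at time `k`, started from `(Y i)ᵀ θ i k`. -/
def fusedSample (θ : Fin N → ℕ → Fin n → ℝ) (k : ℕ) : Fin N → Fin n → ℝ :=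
  S.fuse fun i => (S.Y i)ᵀ *ᵥ θ i k

/-- Stochastic method: the estimate `Υ̃ i k` of `R̃ i` at time `k`, computed recursively. -/
def stochasticEstimate (θ : Fin N → ℕ → Fin n → ℝ) : ℕ → Fin N → Matrix (Fin n) (Fin n) ℝ
  | 0 => fun _ => 0
  | k + 1 => fun i =>
      ((k : ℝ) / (k + 1)) • stochasticEstimate θ k i +
        (1 / ((k : ℝ) + 1)) • Matrix.vecMulVec (S.fusedSample θ (k + 1) i)
          (S.fusedSample θ (k + 1) i)

/-! ### The filter, for a given sequence `U` of estimates of the fused noise covariances -/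

/-- One step of the covariance recursion of the prediction: `A P Aᵀ + Q`. -/
def predictCov (P : Matrix (Fin n) (Fin n) ℝ) : Matrix (Fin n) (Fin n) ℝ :=
  S.A * P * S.Aᵀ + S.Q

/-- The covariance `P i (k|k)` that node `i` computes. -/
def postCov (U : ℕ → Fin N → Matrix (Fin n) (Fin n) ℝ) (i : Fin N) :
    ℕ → Matrix (Fin n) (Fin n) ℝ
  | 0 => S.P0
  | k + 1 => ((S.predictCov (postCov U i k))⁻¹ +
      (S.fusedC i)ᵀ * pinv (U (k + 1) i) * S.fusedC i)⁻¹

/-- The covariance `P i (k+1|k)` that node `i` computes. -/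
def priorCov (U : ℕ → Fin N → Matrix (Fin n) (Fin n) ℝ) (i : Fin N) (k : ℕ) :
    Matrix (Fin n) (Fin n) ℝ :=
  S.predictCov (S.postCov U i k)

section Run

variable {Ω : Type*} (x0 : Ω → Fin n → ℝ) (w : ℕ → Ω → Fin n → ℝ)
  (v : (i : Fin N) → ℕ → Ω → Fin (S.m i) → ℝ)

/-- The state `x k` of the system. -/
def state : ℕ → Ω → Fin n → ℝ
  | 0 => x0
  | k + 1 => fun ω => S.A *ᵥ state k ω + w k ω

/-- The measurement `y i k = C i x k + v i k`. -/
def measurement (i : Fin N) (k : ℕ) (ω : Ω) : Fin (S.m i) → ℝ :=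
  S.C i *ᵥ S.state x0 w k ω + v i k ω

/-- The fused measurement `ỹ i k`, started from `(C i)ᵀ (R i)⁻¹ y i k`. -/
def fusedMeasurement (k : ℕ) (ω : Ω) : Fin N → Fin n → ℝ :=
  S.fuse fun i => ((S.C i)ᵀ * (S.R i)⁻¹) *ᵥ S.measurement x0 w v i k ω

/-- The posterior estimate `x̂ i (k|k)`. -/
def postEst (U : ℕ → Fin N → Matrix (Fin n) (Fin n) ℝ) (i : Fin N) : ℕ → Ω → Fin n → ℝ
  | 0 => fun _ => S.xhat0
  | k + 1 => fun ω => S.postCov U i (k + 1) *ᵥ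
      ((S.priorCov U i k)⁻¹ *ᵥ (S.A *ᵥ postEst U i k ω) +
        ((S.fusedC i)ᵀ * pinv (U (k + 1) i)) *ᵥ S.fusedMeasurement x0 w v (k + 1) ω i)

/-- The error `x (k+1) - x̂ i (k+1|k)` of the prior estimate `x̂ i (k+1|k) = A x̂ i (k|k)`. -/
def priorError (U : ℕ → Fin N → Matrix (Fin n) (Fin n) ℝ) (i : Fin N) (k : ℕ) (ω : Ω) :
    Fin n → ℝ :=
  S.state x0 w (k + 1) ω - S.A *ᵥ S.postEst x0 w v U i k ω

/-- The true covariance `P̃ i (k+1|k)` of the error of the prior estimate: the expectation is over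
the initial state, the disturbances and the measurement noises, for given estimates `U`. -/
def truePriorCov [MeasurableSpace Ω] (μ : Measure Ω) (U : ℕ → Fin N → Matrix (Fin n) (Fin n) ℝ)
    (i : Fin N) (k : ℕ) : Matrix (Fin n) (Fin n) ℝ :=
  secondMoment μ (S.priorError x0 w v U i k) (S.priorError x0 w v U i k)

end Run

end SensorNetwork

end

/-! Put `H = C̃ᵀ R̃† C̃` and let `G = C̃ᵀ U† C̃` be the information matrix that a node actually
uses. With `Φ = (P⁻¹ + G)⁻¹` and `F = A Φ P⁻¹`, the computed prior covariance satisfies `P⁺ = A Φ Aᵀ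
+ Q = F P Fᵀ + A Φ G Φ Aᵀ + Q`. The fused noise has covariance `R̃`, so the true one satisfies the
same recursion with `M = C̃ᵀ U† R̃ U† C̃` in place of the middle `G` (`truePriorCov_succ`). If `U† →
R̃†`, then `G` and `M` both tend to `H`. What remains is the stability of the Riccati recursion and
the convergence of `U†`.

Stability. Observability of `(A, H)` bounds each quadratic form `yᵀ P y` along a run
(`exists_bound_vec`), so `Q ≤ P ≤ β Q` from the second covariance on. Then `F P Fᵀ ≤ P⁺ - Q ≤ (1 -
β⁻¹) P⁺`: the error gain is a strict contraction in the moving norms given by `P`. The difference of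
two runs, and the difference of the true and the computed covariance, obey a linear recursion with
such gains and a vanishing forcing term, hence tend to zero (`tendsto_zero_of_contraction`).
Comparing a run with its own shift, together with compactness, produces the fixed point; comparing
with the constant run gives uniqueness and attraction (`exists_riccati_fixed`).

Convergence of `U†`. The Moore-Penrose inverse jumps where the rank does. Here every estimate, at
every time and for every sample, vanishes on the kernel of `R̃`; together with `U → R̃` this fixes
the rank eventually and gives `U† → R̃†` (`tendsto_pinv`). In the direct method `U → R̃` because
consensus averages the weights to `qᵀ q`, and an invertible `q` then cancels; Gaussian `q` is almost
surely invertible, since the determinant is a nonzero polynomial. In the stochastic method it is the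
strong law of large numbers. -/

noncomputable section

/-! ### Quadratic forms and limits of matrices -/

namespace Matrix

variable {ι κ : Type*} [Fintype ι] [Fintype κ]

omit [Fintype ι] in
theorem PosSemidef.transpose_eq {M : Matrix ι ι ℝ} (h : M.PosSemidef) : Mᵀ = M := by
  simpa [Matrix.conjTranspose_eq_transpose_of_trivial] using h.isHermitian.eq

omit [Fintype ι] in
theorem PosDef.transpose_eq {M : Matrix ι ι ℝ} (h : M.PosDef) : Mᵀ = M :=
  h.posSemidef.transpose_eq

theorem PosSemidef.dotProduct_nonneg {M : Matrix ι ι ℝ} (h : M.PosSemidef) (x : ι → ℝ) :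
    0 ≤ x ⬝ᵥ M *ᵥ x := by simpa using h.dotProduct_mulVec_nonneg x

theorem PosDef.dotProduct_pos {M : Matrix ι ι ℝ} (h : M.PosDef) {x : ι → ℝ} (hx : x ≠ 0) :
    0 < x ⬝ᵥ M *ᵥ x := by simpa using h.dotProduct_mulVec_pos hx

theorem PosSemidef.mul_mul_transpose {M : Matrix ι ι ℝ} (h : M.PosSemidef) (B : Matrix κ ι ℝ) :
    (B * M * Bᵀ).PosSemidef := by
  simpa [Matrix.conjTranspose_eq_transpose_of_trivial] using h.mul_mul_conjTranspose_same B

theorem PosSemidef.transpose_mul_mul {M : Matrix ι ι ℝ} (h : M.PosSemidef) (B : Matrix ι κ ℝ) :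
    (Bᵀ * M * B).PosSemidef := by
  simpa [Matrix.conjTranspose_eq_transpose_of_trivial] using h.conjTranspose_mul_mul_same B

theorem posSemidef_transpose_mul_self (B : Matrix ι κ ℝ) : (Bᵀ * B).PosSemidef := by
  simpa [Matrix.conjTranspose_eq_transpose_of_trivial] using posSemidef_conjTranspose_mul_self B

theorem dotProduct_mulVec_mul_mul (B : Matrix κ ι ℝ) (M : Matrix ι ι ℝ) (C : Matrix κ ι ℝ)
    (x y : κ → ℝ) : x ⬝ᵥ (B * M * Cᵀ) *ᵥ y = (Bᵀ *ᵥ x) ⬝ᵥ M *ᵥ (Cᵀ *ᵥ y) := by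
  rw [← Matrix.mulVec_mulVec, ← Matrix.mulVec_mulVec, Matrix.dotProduct_mulVec,
    ← Matrix.mulVec_transpose]

theorem dotProduct_mulVec_comm_of_symm {M : Matrix ι ι ℝ} (h : Mᵀ = M) (x y : ι → ℝ) :
    x ⬝ᵥ M *ᵥ y = y ⬝ᵥ M *ᵥ x := by
  rw [Matrix.dotProduct_mulVec, ← Matrix.mulVec_transpose, h, dotProduct_comm]

/-- Cauchy-Schwarz for a positive semidefinite form. -/
theorem PosSemidef.sq_dotProduct_le {M : Matrix ι ι ℝ} (h : M.PosSemidef) (x y : ι → ℝ) :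
    (x ⬝ᵥ M *ᵥ y) ^ 2 ≤ (x ⬝ᵥ M *ᵥ x) * (y ⬝ᵥ M *ᵥ y) := by
  have key : ∀ t : ℝ, 0 ≤ (y ⬝ᵥ M *ᵥ y) * (t * t) + (2 * (x ⬝ᵥ M *ᵥ y)) * t + x ⬝ᵥ M *ᵥ x := by
    intro t
    have := h.dotProduct_nonneg (x + t • y)
    simp only [Matrix.mulVec_add, Matrix.mulVec_smul, add_dotProduct, dotProduct_add,
      smul_dotProduct, dotProduct_smul, smul_eq_mul,
      dotProduct_mulVec_comm_of_symm h.transpose_eq y x] at this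
    linarith
  have := discrim_le_zero key
  unfold discrim at this
  linarith

/-- Cauchy-Schwarz against the test vector `M *ᵥ x` forces `|M x|⁴ ≤ 0`. -/
theorem PosSemidef.dotProduct_eq_zero_iff {M : Matrix ι ι ℝ} (h : M.PosSemidef) (x : ι → ℝ) :
    x ⬝ᵥ M *ᵥ x = 0 ↔ M *ᵥ x = 0 := by
  refine ⟨fun h0 => ?_, fun h0 => by rw [h0, dotProduct_zero]⟩
  have := h.sq_dotProduct_le (M *ᵥ x) x
  rw [h0, mul_zero] at this
  exact dotProduct_self_eq_zero.mp (pow_eq_zero_iff two_ne_zero |>.mp (this.antisymm (sq_nonneg _)))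

omit [Fintype ι] [Fintype κ] in
theorem tendsto_iff_entries {α : Type*} {l : Filter α} {f : α → Matrix ι κ ℝ}
    {M : Matrix ι κ ℝ} : Tendsto f l (𝓝 M) ↔ ∀ a b, Tendsto (fun k => f k a b) l (𝓝 (M a b)) := by
  refine (tendsto_pi_nhds (f := f) (g := M)).trans (forall_congr' fun a => ?_)
  exact tendsto_pi_nhds (f := fun k => f k a)

omit [Fintype ι] in
theorem tendsto_mul {α : Type*} {l : Filter α} {μ : Type*} {f : α → Matrix ι κ ℝ}
    {g : α → Matrix κ μ ℝ} {M : Matrix ι κ ℝ} {N : Matrix κ μ ℝ}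
    (hf : Tendsto f l (𝓝 M)) (hg : Tendsto g l (𝓝 N)) :
    Tendsto (fun k => f k * g k) l (𝓝 (M * N)) := by
  have h : Continuous fun p : Matrix ι κ ℝ × Matrix κ μ ℝ => p.1 * p.2 :=
    continuous_fst.matrix_mul continuous_snd
  exact (h.tendsto (M, N)).comp (hf.prodMk_nhds hg)

theorem tendsto_dotProduct_mulVec {α : Type*} {l : Filter α} {f : α → Matrix ι κ ℝ}
    {M : Matrix ι κ ℝ} (hf : Tendsto f l (𝓝 M)) (x : ι → ℝ) (y : κ → ℝ) :
    Tendsto (fun k => x ⬝ᵥ f k *ᵥ y) l (𝓝 (x ⬝ᵥ M *ᵥ y)) := by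
  have h : Continuous fun K : Matrix ι κ ℝ => x ⬝ᵥ K *ᵥ y :=
    continuous_const.dotProduct (continuous_id.matrix_mulVec continuous_const)
  exact (h.tendsto M).comp hf

theorem tendsto_inv [DecidableEq ι] {α : Type*} {l : Filter α} {f : α → Matrix ι ι ℝ}
    {M : Matrix ι ι ℝ} (hM : IsUnit M.det) (hf : Tendsto f l (𝓝 M)) :
    Tendsto (fun k => (f k)⁻¹) l (𝓝 M⁻¹) := by
  refine (continuousAt_matrix_inv M ?_).tendsto.comp hf
  have := NormedRing.inverse_continuousAt hM.unit
  simpa using this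

theorem eventually_isUnit_det [DecidableEq ι] {α : Type*} {l : Filter α} {f : α → Matrix ι ι ℝ}
    {M : Matrix ι ι ℝ} (hM : IsUnit M.det) (hf : Tendsto f l (𝓝 M)) :
    ∀ᶠ k in l, IsUnit (f k).det := by
  have h := ((continuous_id.matrix_det : Continuous fun K : Matrix ι ι ℝ => K.det).tendsto M).comp hf
  exact (h.eventually_ne hM.ne_zero).mono fun k hk => isUnit_iff_ne_zero.mpr hk

theorem PosDef.isUnit_det [DecidableEq ι] {M : Matrix ι ι ℝ} (h : M.PosDef) : IsUnit M.det :=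
  (Matrix.isUnit_iff_isUnit_det _).mp h.isUnit

end Matrix

/-! ### Moore-Penrose inverses of symmetric matrices and their continuity -/

section PinvLemmas

variable {ι κ : Type*} [Fintype ι] [Fintype κ]

theorem IsMoorePenrose.pinv_eq {M : Matrix ι κ ℝ} {X : Matrix κ ι ℝ} (h : IsMoorePenrose M X) :
    pinv M = X := (pinv_spec M).unique h

theorem pinv_transpose_of_symm {M : Matrix ι ι ℝ} (h : Mᵀ = M) : (pinv M)ᵀ = pinv M := by
  have hs := pinv_spec M
  refine (IsMoorePenrose.pinv_eq ⟨?_, ?_, ?_, ?_⟩).symm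
  · have := congrArg transpose hs.mul_mul_self
    simpa only [transpose_mul, h, Matrix.mul_assoc] using this
  · have := congrArg transpose hs.mul_mul_inv
    simpa only [transpose_mul, h, Matrix.mul_assoc] using this
  · have := hs.symm_right
    rw [transpose_mul, h] at this
    rw [transpose_mul, transpose_transpose, h, this]
  · have := hs.symm_left
    rw [transpose_mul, h] at this
    rw [transpose_mul, transpose_transpose, h, this]

theorem mul_pinv_comm_of_symm {M : Matrix ι ι ℝ} (h : Mᵀ = M) : M * pinv M = pinv M * M := by
  have := (pinv_spec M).symm_left
  rwa [transpose_mul, h, pinv_transpose_of_symm h, eq_comm] at this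

/-- `M†` is symmetric, so `M† = M† M M†` is a congruence of `M`. -/
theorem posSemidef_pinv {M : Matrix ι ι ℝ} (h : M.PosSemidef) : (pinv M).PosSemidef := by
  have := h.mul_mul_transpose (pinv M)
  rwa [pinv_transpose_of_symm h.transpose_eq, (pinv_spec M).mul_mul_inv] at this

/-- Symmetric `M` commutes with `M†`, hence `M = M M M†`. -/
theorem mulVec_eq_zero_of_pinv_mulVec {M : Matrix ι ι ℝ} (h : Mᵀ = M) {x : ι → ℝ}
    (hx : pinv M *ᵥ x = 0) : M *ᵥ x = 0 := by
  rw [← (pinv_spec M).mul_mul_self, Matrix.mul_assoc, ← mul_pinv_comm_of_symm h, ← Matrix.mul_assoc,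
    ← Matrix.mulVec_mulVec, hx, Matrix.mulVec_zero]

/-- A matrix whose kernel contains the kernel of `M` is unchanged by `M† M`. -/
theorem mul_pinv_mul_of_ker {M : Matrix κ ι ℝ} {lam : Type*} {B : Matrix lam ι ℝ}
    (hker : ∀ x, M *ᵥ x = 0 → B *ᵥ x = 0) : B * (pinv M * M) = B := by
  classical
  have h1 : B * (1 - pinv M * M) = 0 := by
    refine Matrix.ext_of_mulVec_single fun i => ?_
    rw [← Matrix.mulVec_mulVec, hker, Matrix.zero_mulVec]
    rw [Matrix.mulVec_mulVec, Matrix.mul_sub, Matrix.mul_one, ← Matrix.mul_assoc,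
      (pinv_spec M).mul_mul_self, sub_self, Matrix.zero_mulVec]
  rw [Matrix.mul_sub, Matrix.mul_one, sub_eq_zero] at h1
  exact h1.symm

theorem pinv_eq_inv [DecidableEq ι] {M : Matrix ι ι ℝ} (h : IsUnit M.det) : pinv M = M⁻¹ := by
  refine IsMoorePenrose.pinv_eq ⟨?_, ?_, ?_, ?_⟩ <;>
    simp [Matrix.mul_nonsing_inv _ h, Matrix.nonsing_inv_mul _ h]

/-- The Moore-Penrose inverse of a symmetric matrix, from the inverse of its sum with the
projection on the kernel of a symmetric matrix `M`. -/
theorem pinv_eq_inv_add_sub [DecidableEq ι] {M B : Matrix ι ι ℝ} (hB : Bᵀ = B)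
    (hker : ∀ x, M *ᵥ x = 0 → B *ᵥ x = 0) (hu : IsUnit (B + (1 - pinv M * M)).det) :
    pinv B = (B + (1 - pinv M * M))⁻¹ - (1 - pinv M * M) ∧ pinv B * B = pinv M * M := by
  set p := pinv M * M with hp
  have hpp : p * p = p := by
    rw [hp, ← Matrix.mul_assoc, (pinv_spec M).mul_mul_inv]
  have hBp : B * p = B := mul_pinv_mul_of_ker hker
  have hpT : pᵀ = p := (pinv_spec M).symm_right
  have hpB : p * B = B := by
    have := congrArg transpose hBp
    rwa [transpose_mul, hB, hpT] at this
  set Z := (B + (1 - p))⁻¹ with hZ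
  have hZ1 : (B + (1 - p)) * Z = 1 := Matrix.mul_nonsing_inv _ hu
  have hZ2 : Z * (B + (1 - p)) = 1 := Matrix.nonsing_inv_mul _ hu
  -- `B` lives on the range of the orthogonal projection `p`, so `B + (1 - p)` is block diagonal
  -- with an identity block on the complement; its inverse `Z` respects the same splitting.
  have hpZ : (1 - p) * Z = 1 - p := by
    have : (1 - p) * ((B + (1 - p)) * Z) = (1 - p) * Z := by
      rw [← Matrix.mul_assoc]
      congr 1
      noncomm_ring [hpB, hpp]
    rw [← this, hZ1, Matrix.mul_one]
  have hZp : Z * (1 - p) = 1 - p := by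
    have : (Z * (B + (1 - p))) * (1 - p) = Z * (1 - p) := by
      rw [Matrix.mul_assoc]
      congr 1
      noncomm_ring [hBp, hpp]
    rw [← this, hZ2, Matrix.one_mul]
  have hBZ : B * Z = p := by
    rw [Matrix.add_mul, hpZ] at hZ1
    rw [eq_sub_of_add_eq hZ1]; abel
  have hZB : Z * B = p := by
    rw [Matrix.mul_add, hZp] at hZ2
    rw [eq_sub_of_add_eq hZ2]; abel
  have hBX : B * (Z - (1 - p)) = p := by
    rw [Matrix.mul_sub, hBZ, Matrix.mul_sub, hBp, Matrix.mul_one, sub_self, sub_zero]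
  have hXB : (Z - (1 - p)) * B = p := by
    rw [Matrix.sub_mul, hZB, Matrix.sub_mul, hpB, Matrix.one_mul, sub_self, sub_zero]
  have hX : pinv B = Z - (1 - p) := by
    refine IsMoorePenrose.pinv_eq ⟨?_, ?_, ?_, ?_⟩
    · rw [hBX, hpB]
    · rw [hXB, Matrix.mul_sub, Matrix.mul_sub, Matrix.mul_one, hpp, sub_self, sub_zero]
      have : Z - (1 - p) = Z * p := by
        rw [Matrix.mul_sub, Matrix.mul_one] at hZp
        rw [← hZp]; abel
      rw [this]
      have h2 : p * Z = Z * p := by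
        rw [Matrix.mul_sub, Matrix.mul_one] at hZp
        rw [Matrix.sub_mul, Matrix.one_mul] at hpZ
        have := hZp.trans hpZ.symm
        exact (sub_right_injective this).symm
      exact h2
    · rw [hBX, hpT]
    · rw [hXB, hpT]
  exact ⟨hX, by rw [hX, hXB]⟩

/-- With `p = M† M`, the sum is `M` on the range of `p` and the identity on its complement, so `M† +
(1 - p)` inverts it. -/
theorem isUnit_det_add_one_sub_pinv_mul [DecidableEq ι] {M : Matrix ι ι ℝ} (hM : Mᵀ = M) :
    IsUnit (M + (1 - pinv M * M)).det := by
  set p := pinv M * M with hp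
  have hMp : M * p = M := mul_pinv_mul_of_ker fun _ h => h
  have hpX : p * pinv M = pinv M := (pinv_spec M).mul_mul_inv
  have hMX : M * pinv M = p := mul_pinv_comm_of_symm hM
  have hpp : p * p = p := by
    rw [hp, ← Matrix.mul_assoc, (pinv_spec M).mul_mul_inv]
  refine Matrix.isUnit_det_of_right_inverse (B := pinv M + (1 - p)) ?_
  have : (M + (1 - p)) * (pinv M + (1 - p))
      = M * pinv M + (M - M * p) + (pinv M - p * pinv M) + (1 - p - (p - p * p)) := by
    noncomm_ring
  rw [this, hMX, hMp, hpX, hpp]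
  abel

/-- The Moore-Penrose inverse is continuous along symmetric matrices whose kernel does not
shrink. -/
theorem tendsto_pinv {α : Type*} {l : Filter α} {f : α → Matrix ι ι ℝ} {M : Matrix ι ι ℝ}
    (hM : Mᵀ = M) (hf : ∀ k, (f k)ᵀ = f k) (hker : ∀ k x, M *ᵥ x = 0 → f k *ᵥ x = 0)
    (hlim : Tendsto f l (𝓝 M)) :
    Tendsto (fun k => pinv (f k)) l (𝓝 (pinv M)) ∧
      ∀ᶠ k in l, pinv (f k) * f k = pinv M * M := by
  classical
  have hu := isUnit_det_add_one_sub_pinv_mul hM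
  have hlim' : Tendsto (fun k => f k + (1 - pinv M * M)) l (𝓝 (M + (1 - pinv M * M))) :=
    hlim.add_const _
  have hev := Matrix.eventually_isUnit_det hu hlim'
  have hinv := (Matrix.tendsto_inv hu hlim').sub_const (1 - pinv M * M)
  rw [← (pinv_eq_inv_add_sub hM (fun _ h => h) hu).1] at hinv
  refine ⟨hinv.congr' ?_, ?_⟩
  · exact hev.mono fun k hk => (pinv_eq_inv_add_sub (hf k) (hker k) hk).1.symm
  · exact hev.mono fun k hk => (pinv_eq_inv_add_sub (hf k) (hker k) hk).2

end PinvLemmas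

/-! ### One Riccati step: bounds, contraction and perturbation -/

section Riccati

variable {ι : Type*} [Fintype ι] [DecidableEq ι]

/-- The information update `(P⁻¹ + G)⁻¹`. -/
def infoUpdate (P G : Matrix ι ι ℝ) : Matrix ι ι ℝ := (P⁻¹ + G)⁻¹

/-- One step `A (P⁻¹ + G)⁻¹ Aᵀ + Q` of the Riccati recursion. -/
def riccatiStep (A Q P G : Matrix ι ι ℝ) : Matrix ι ι ℝ := A * infoUpdate P G * Aᵀ + Q

/-- The transition matrix of the filtering error. -/
def errorGain (A P G : Matrix ι ι ℝ) : Matrix ι ι ℝ := A * infoUpdate P G * P⁻¹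

-- Cauchy-Schwarz. Used with `M = P⁻¹` and with `M = G`, this replaces the antitonicity of matrix
-- inversion in the two bounds on `infoUpdate`.
omit [DecidableEq ι] in
theorem Matrix.PosSemidef.le_of_dotProduct_le {M : Matrix ι ι ℝ} (hM : M.PosSemidef)
    {x z : ι → ℝ} (h : z ⬝ᵥ M *ᵥ z ≤ x ⬝ᵥ M *ᵥ z) : x ⬝ᵥ M *ᵥ z ≤ x ⬝ᵥ M *ᵥ x := by
  have h1 := hM.sq_dotProduct_le x z
  have h2 := hM.dotProduct_nonneg x
  rcases le_or_gt (x ⬝ᵥ M *ᵥ z) 0 with h0 | h0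
  · exact h0.trans h2
  · have h3 := mul_le_mul_of_nonneg_left h h2
    nlinarith

theorem infoUpdate_posDef {P G : Matrix ι ι ℝ} (hP : P.PosDef) (hG : G.PosSemidef) :
    (infoUpdate P G).PosDef := (hP.inv.add_posSemidef hG).inv

theorem infoUpdate_mul {P G : Matrix ι ι ℝ} (hP : P.PosDef) (hG : G.PosSemidef) :
    infoUpdate P G * (P⁻¹ + G) = 1 :=
  Matrix.nonsing_inv_mul _ (hP.inv.add_posSemidef hG).isUnit_det

theorem mul_infoUpdate {P G : Matrix ι ι ℝ} (hP : P.PosDef) (hG : G.PosSemidef) :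
    (P⁻¹ + G) * infoUpdate P G = 1 :=
  Matrix.mul_nonsing_inv _ (hP.inv.add_posSemidef hG).isUnit_det

/-- The Joseph form: insert `(P⁻¹ + G) Φ = 1`. The first term is the propagated prior error, the
second the contribution of the measurement noise. -/
theorem infoUpdate_eq {P G : Matrix ι ι ℝ} (hP : P.PosDef) (hG : G.PosSemidef) :
    infoUpdate P G =
      infoUpdate P G * P⁻¹ * infoUpdate P G + infoUpdate P G * G * infoUpdate P G := by
  rw [← Matrix.add_mul, ← Matrix.mul_add, infoUpdate_mul hP hG, Matrix.one_mul]

theorem dotProduct_infoUpdate_eq {P G : Matrix ι ι ℝ} (hP : P.PosDef) (hG : G.PosSemidef)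
    (y : ι → ℝ) : y ⬝ᵥ infoUpdate P G *ᵥ y =
      (infoUpdate P G *ᵥ y) ⬝ᵥ P⁻¹ *ᵥ (infoUpdate P G *ᵥ y) +
        (infoUpdate P G *ᵥ y) ⬝ᵥ G *ᵥ (infoUpdate P G *ᵥ y) := by
  have hT := (infoUpdate_posDef hP hG).transpose_eq
  conv_lhs => rw [infoUpdate_eq hP hG]
  rw [Matrix.add_mulVec, dotProduct_add]
  nth_rw 2 [← hT]
  nth_rw 4 [← hT]
  rw [dotProduct_mulVec_mul_mul, dotProduct_mulVec_mul_mul, hT]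

theorem dotProduct_infoUpdate_le {P G : Matrix ι ι ℝ} (hP : P.PosDef) (hG : G.PosSemidef)
    (y : ι → ℝ) : y ⬝ᵥ infoUpdate P G *ᵥ y ≤ y ⬝ᵥ P *ᵥ y := by
  have hu := hP.isUnit_det
  have h1 : ∀ u : ι → ℝ, (P *ᵥ y) ⬝ᵥ P⁻¹ *ᵥ u = y ⬝ᵥ u := fun u => by
    rw [← hP.transpose_eq, Matrix.mulVec_transpose, ← Matrix.dotProduct_mulVec, hP.transpose_eq,
      Matrix.mulVec_mulVec, Matrix.mul_nonsing_inv _ hu, Matrix.one_mulVec]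
  have h2 := hP.inv.posSemidef.le_of_dotProduct_le (x := P *ᵥ y) (z := infoUpdate P G *ᵥ y) ?_
  · rwa [h1, h1] at h2
  · rw [h1, dotProduct_infoUpdate_eq hP hG]
    linarith [hG.dotProduct_nonneg (infoUpdate P G *ᵥ y)]

/-- The bound does not involve `P`: in measured directions the posterior covariance is controlled by
the measurement alone. This is the source of the uniform bound on a Riccati run. -/
theorem dotProduct_infoUpdate_range_le {P G : Matrix ι ι ℝ} (hP : P.PosDef) (hG : G.PosSemidef)
    (x : ι → ℝ) : (G *ᵥ x) ⬝ᵥ infoUpdate P G *ᵥ (G *ᵥ x) ≤ x ⬝ᵥ G *ᵥ x := by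
  have h1 : ∀ u : ι → ℝ, (G *ᵥ x) ⬝ᵥ u = x ⬝ᵥ G *ᵥ u := fun u => by
    conv_lhs => rw [← hG.transpose_eq]
    rw [Matrix.mulVec_transpose, ← Matrix.dotProduct_mulVec]
  have h2 := hG.le_of_dotProduct_le (x := x) (z := infoUpdate P G *ᵥ (G *ᵥ x)) ?_
  · rwa [← h1] at h2
  · rw [← h1, dotProduct_infoUpdate_eq hP hG]
    linarith [hP.inv.posSemidef.dotProduct_nonneg (infoUpdate P G *ᵥ (G *ᵥ x))]

theorem dotProduct_riccatiStep {A Q P G : Matrix ι ι ℝ} (x : ι → ℝ) :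
    x ⬝ᵥ riccatiStep A Q P G *ᵥ x =
      (Aᵀ *ᵥ x) ⬝ᵥ infoUpdate P G *ᵥ (Aᵀ *ᵥ x) + x ⬝ᵥ Q *ᵥ x := by
  rw [riccatiStep, Matrix.add_mulVec, dotProduct_add, dotProduct_mulVec_mul_mul]

theorem riccatiStep_posDef {A Q P G : Matrix ι ι ℝ} (hQ : Q.PosDef) (hP : P.PosDef)
    (hG : G.PosSemidef) : (riccatiStep A Q P G).PosDef :=
  hQ.posSemidef_add ((infoUpdate_posDef hP hG).posSemidef.mul_mul_transpose A)

theorem le_dotProduct_riccatiStep {A Q P G : Matrix ι ι ℝ} (hP : P.PosDef)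
    (hG : G.PosSemidef) (x : ι → ℝ) : x ⬝ᵥ Q *ᵥ x ≤ x ⬝ᵥ riccatiStep A Q P G *ᵥ x := by
  rw [dotProduct_riccatiStep]
  linarith [(infoUpdate_posDef hP hG).posSemidef.dotProduct_nonneg (Aᵀ *ᵥ x)]

theorem errorGain_transpose {A P G : Matrix ι ι ℝ} (hP : P.PosDef) (hG : G.PosSemidef) :
    (errorGain A P G)ᵀ = P⁻¹ * infoUpdate P G * Aᵀ := by
  rw [errorGain, transpose_mul, transpose_mul, (infoUpdate_posDef hP hG).transpose_eq,
    hP.inv.transpose_eq, Matrix.mul_assoc]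

/-- Drop the noise term `Φ G Φ` of the Joseph form. The remaining loss `Q` is what makes the error
gain a strict contraction once `P` is bounded by a multiple of `Q`. -/
theorem errorGain_contraction {A Q P G : Matrix ι ι ℝ} (hP : P.PosDef)
    (hG : G.PosSemidef) (x : ι → ℝ) :
    ((errorGain A P G)ᵀ *ᵥ x) ⬝ᵥ P *ᵥ ((errorGain A P G)ᵀ *ᵥ x) + x ⬝ᵥ Q *ᵥ x ≤
      x ⬝ᵥ riccatiStep A Q P G *ᵥ x := by
  rw [dotProduct_riccatiStep, dotProduct_infoUpdate_eq hP hG, errorGain_transpose hP hG]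
  have h : ∀ z : ι → ℝ, (P⁻¹ *ᵥ z) ⬝ᵥ P *ᵥ (P⁻¹ *ᵥ z) = z ⬝ᵥ P⁻¹ *ᵥ z := fun z => by
    rw [Matrix.mulVec_mulVec, Matrix.mul_nonsing_inv _ hP.isUnit_det, Matrix.one_mulVec,
      dotProduct_comm]
  rw [Matrix.mul_assoc, ← Matrix.mulVec_mulVec, h, ← Matrix.mulVec_mulVec]
  linarith [hG.dotProduct_nonneg (infoUpdate P G *ᵥ (Aᵀ *ᵥ x))]

/-- Resolvent identity: `Φ - Φ' = Φ ((P'⁻¹ - P⁻¹) + (G' - G)) Φ'`. Having one gain from each run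
makes the difference exactly bilinear, with no remainder of second order. -/
theorem riccatiStep_sub_riccatiStep {A Q P G P' G' : Matrix ι ι ℝ} (hP : P.PosDef)
    (hG : G.PosSemidef) (hP' : P'.PosDef) (hG' : G'.PosSemidef) :
    riccatiStep A Q P G - riccatiStep A Q P' G' =
      errorGain A P G * (P - P') * (errorGain A P' G')ᵀ +
        A * infoUpdate P G * (G' - G) * (infoUpdate P' G' * Aᵀ) := by
  rw [errorGain_transpose hP' hG', errorGain, riccatiStep, riccatiStep]
  have h1 : P⁻¹ * (P - P') * P'⁻¹ = P'⁻¹ - P⁻¹ := by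
    rw [Matrix.mul_sub, Matrix.sub_mul, Matrix.nonsing_inv_mul _ hP.isUnit_det, Matrix.one_mul,
      Matrix.mul_assoc, Matrix.mul_nonsing_inv _ hP'.isUnit_det, Matrix.mul_one]
  have h2 : infoUpdate P G - infoUpdate P' G' =
      infoUpdate P G * (P⁻¹ * (P - P') * P'⁻¹ + (G' - G)) * infoUpdate P' G' := by
    have : P'⁻¹ - P⁻¹ + (G' - G) = (P'⁻¹ + G') - (P⁻¹ + G) := by abel
    rw [h1, this, Matrix.mul_sub, Matrix.sub_mul, infoUpdate_mul hP hG, Matrix.one_mul,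
      Matrix.mul_assoc, mul_infoUpdate hP' hG', Matrix.mul_one]
  calc _ = A * (infoUpdate P G - infoUpdate P' G') * Aᵀ := by noncomm_ring
    _ = _ := by rw [h2]; noncomm_ring

theorem le_of_affine_recursion_tendsto {ρ : ℝ} (h0 : 0 ≤ ρ) (h1 : ρ < 1) {c e : ℕ → ℝ}
    (hc : ∀ k, 0 ≤ c k) (he : Tendsto e atTop (𝓝 0)) (hrec : ∀ k, c (k + 1) ≤ ρ * c k + e k) :
    Tendsto c atTop (𝓝 0) := by
  rw [Metric.tendsto_atTop]
  intro ε hε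
  -- A constant forcing of this size has the steady state `ε / 2`.
  have hδ : 0 < (1 - ρ) * (ε / 2) := mul_pos (by linarith) (by linarith)
  obtain ⟨K, hK⟩ := eventually_atTop.mp (he.eventually (gt_mem_nhds hδ))
  have hind : ∀ m, c (K + m) ≤ ρ ^ m * c K + ε / 2 := by
    intro m
    induction m with
    | zero => simp; linarith
    | succ m ih =>
      have h2 := hrec (K + m)
      have h3 := hK (K + m) (by omega)
      have h4 := mul_le_mul_of_nonneg_left ih h0
      rw [pow_succ]
      have : c (K + (m + 1)) = c (K + m + 1) := rfl
      nlinarith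
  have hgeo : Tendsto (fun m => ρ ^ m * c K) atTop (𝓝 0) := by
    simpa using (tendsto_pow_atTop_nhds_zero_of_lt_one h0 h1).mul_const (c K)
  obtain ⟨M, hM⟩ := eventually_atTop.mp (hgeo.eventually (gt_mem_nhds (half_pos hε)))
  refine ⟨K + M, fun k hk => ?_⟩
  obtain ⟨m, rfl⟩ := Nat.exists_eq_add_of_le (le_of_add_le_left hk)
  have := hM m (by omega)
  rw [Real.dist_eq, sub_zero, abs_of_nonneg (hc _)]
  linarith [hind m]

/-- A positive definite form dominates every bilinear form. -/
theorem abs_dotProduct_mulVec_le {Q : Matrix ι ι ℝ} (hQ : Q.PosDef) (E : Matrix ι ι ℝ)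
    (x y : ι → ℝ) : |x ⬝ᵥ E *ᵥ y| ≤ (∑ a, ∑ b, |E a b|) * (Q⁻¹).trace *
      (√(x ⬝ᵥ Q *ᵥ x) * √(y ⬝ᵥ Q *ᵥ y)) := by
  have hdiag : ∀ a, 0 ≤ (Q⁻¹) a a := fun a => hQ.inv.posSemidef.diag_nonneg
  -- Cauchy-Schwarz for `Q⁻¹` between a unit vector and `Q x` gives `x a ^ 2 ≤ (Q⁻¹) a a * (x ⬝ᵥ Q
  -- x)`.
  have hc : ∀ (x : ι → ℝ) a, |x a| ≤ √((Q⁻¹).trace) * √(x ⬝ᵥ Q *ᵥ x) := by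
    intro x a
    rw [← Real.sqrt_mul (hQ.inv.posSemidef.trace_nonneg)]
    apply Real.abs_le_sqrt
    have h := hQ.inv.posSemidef.sq_dotProduct_le (Pi.single a 1) (Q *ᵥ x)
    rw [Matrix.mulVec_mulVec, Matrix.nonsing_inv_mul _ hQ.isUnit_det, Matrix.one_mulVec,
      single_one_dotProduct, single_one_dotProduct, Matrix.mulVec_single_one,
      dotProduct_comm (Q *ᵥ x)] at h
    refine h.trans (mul_le_mul_of_nonneg_right ?_ (hQ.posSemidef.dotProduct_nonneg x))
    exact Finset.single_le_sum (f := fun a => (Q⁻¹) a a) (fun i _ => hdiag i) (Finset.mem_univ a)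
  have ht := Real.mul_self_sqrt (hQ.inv.posSemidef.trace_nonneg)
  calc |x ⬝ᵥ E *ᵥ y| = |∑ a, ∑ b, x a * (E a b * y b)| := by
        simp only [dotProduct, Matrix.mulVec, Finset.mul_sum]
    _ ≤ ∑ a, ∑ b, |x a * (E a b * y b)| :=
        (Finset.abs_sum_le_sum_abs _ _).trans
          (Finset.sum_le_sum fun a _ => Finset.abs_sum_le_sum_abs _ _)
    _ ≤ ∑ a, ∑ b, |E a b| * ((Q⁻¹).trace * (√(x ⬝ᵥ Q *ᵥ x) * √(y ⬝ᵥ Q *ᵥ y))) := by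
        refine Finset.sum_le_sum fun a _ => Finset.sum_le_sum fun b _ => ?_
        have h3 := mul_le_mul (hc x a) (hc y b) (abs_nonneg _) (by positivity)
        calc |x a * (E a b * y b)| = |E a b| * (|x a| * |y b|) := by
              rw [abs_mul, abs_mul]; ring
          _ ≤ |E a b| * (√((Q⁻¹).trace) * √(x ⬝ᵥ Q *ᵥ x) *
                (√((Q⁻¹).trace) * √(y ⬝ᵥ Q *ᵥ y))) :=
              mul_le_mul_of_nonneg_left h3 (abs_nonneg _)
          _ = |E a b| * ((√((Q⁻¹).trace) * √((Q⁻¹).trace)) *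
                (√(x ⬝ᵥ Q *ᵥ x) * √(y ⬝ᵥ Q *ᵥ y))) := by ring
          _ = _ := by rw [ht]
    _ = _ := by
        simp only [← Finset.sum_mul]; ring

/-- A perturbed bilinear recursion whose two transition matrices are contractions for bounded
moving positive definite forms tends to zero. -/
theorem tendsto_zero_of_contraction {Q : Matrix ι ι ℝ} (hQ : Q.PosDef)
    {P P' D F F' E : ℕ → Matrix ι ι ℝ} {β : ℝ} (hβ : 1 ≤ β)
    (hP : ∀ k x, x ⬝ᵥ Q *ᵥ x ≤ x ⬝ᵥ P k *ᵥ x) (hP' : ∀ k x, x ⬝ᵥ Q *ᵥ x ≤ x ⬝ᵥ P' k *ᵥ x)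
    (hPβ : ∀ k x, x ⬝ᵥ P k *ᵥ x ≤ β * (x ⬝ᵥ Q *ᵥ x))
    (hPβ' : ∀ k x, x ⬝ᵥ P' k *ᵥ x ≤ β * (x ⬝ᵥ Q *ᵥ x))
    (hF : ∀ k x, ((F k)ᵀ *ᵥ x) ⬝ᵥ P k *ᵥ ((F k)ᵀ *ᵥ x) + x ⬝ᵥ Q *ᵥ x ≤ x ⬝ᵥ P (k + 1) *ᵥ x)
    (hF' : ∀ k x, ((F' k)ᵀ *ᵥ x) ⬝ᵥ P' k *ᵥ ((F' k)ᵀ *ᵥ x) + x ⬝ᵥ Q *ᵥ x ≤ x ⬝ᵥ P' (k + 1) *ᵥ x)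
    (hD : ∀ k, D (k + 1) = F k * D k * (F' k)ᵀ + E k) (hE : Tendsto E atTop (𝓝 0)) :
    Tendsto D atTop (𝓝 0) := by
  -- `c k` will bound the bilinear form `D k` relative to the norms given by `P k` on the left and
  -- `P' k` on the right. Measuring with the moving forms lets each of the two gains contribute a
  -- factor `√(1 - β⁻¹)`.
  set c : ℕ → ℝ := fun k => Nat.rec ((∑ a, ∑ b, |D 0 a b|) * (Q⁻¹).trace)
    (fun k ck => (1 - β⁻¹) * ck + (∑ a, ∑ b, |E k a b|) * (Q⁻¹).trace) k with hcdef
  have htr := hQ.inv.posSemidef.trace_nonneg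
  have hβ0 : 0 < β := by linarith
  have hρ0 : 0 ≤ 1 - β⁻¹ := sub_nonneg.mpr (inv_le_one_of_one_le₀ hβ)
  have hρ1 : 1 - β⁻¹ < 1 := by linarith [inv_pos.mpr hβ0]
  have hsum : ∀ M : Matrix ι ι ℝ, 0 ≤ (∑ a, ∑ b, |M a b|) * (Q⁻¹).trace := fun M =>
    mul_nonneg (Finset.sum_nonneg fun a _ => Finset.sum_nonneg fun b _ => abs_nonneg _) htr
  have hcs : ∀ k, c (k + 1) = (1 - β⁻¹) * c k + (∑ a, ∑ b, |E k a b|) * (Q⁻¹).trace :=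
    fun k => rfl
  have hc0 : ∀ k, 0 ≤ c k := by
    intro k
    induction k with
    | zero => exact hsum _
    | succ k ih => rw [hcs]; exact add_nonneg (mul_nonneg hρ0 ih) (hsum _)
  -- Since `Q ≥ β⁻¹ P`, the loss `Q` becomes the factor `1 - β⁻¹`.
  have hcontr : ∀ (P F : ℕ → Matrix ι ι ℝ),
      (∀ k x, x ⬝ᵥ P k *ᵥ x ≤ β * (x ⬝ᵥ Q *ᵥ x)) →
      (∀ k x, ((F k)ᵀ *ᵥ x) ⬝ᵥ P k *ᵥ ((F k)ᵀ *ᵥ x) + x ⬝ᵥ Q *ᵥ x ≤ x ⬝ᵥ P (k + 1) *ᵥ x) →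
      ∀ k x, √(((F k)ᵀ *ᵥ x) ⬝ᵥ P k *ᵥ ((F k)ᵀ *ᵥ x)) ≤
        √(1 - β⁻¹) * √(x ⬝ᵥ P (k + 1) *ᵥ x) := by
    intro P F hPβ hF k x
    rw [← Real.sqrt_mul hρ0]
    apply Real.sqrt_le_sqrt
    have h1 := hF k x
    have h2 := mul_le_mul_of_nonneg_left (hPβ (k + 1) x) (inv_pos.mpr hβ0).le
    rw [← mul_assoc, inv_mul_cancel₀ hβ0.ne', one_mul] at h2
    linarith
  have hmain : ∀ k x y, |x ⬝ᵥ D k *ᵥ y| ≤ c k * (√(x ⬝ᵥ P k *ᵥ x) * √(y ⬝ᵥ P' k *ᵥ y)) := by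
    intro k
    induction k with
    | zero =>
      intro x y
      refine (abs_dotProduct_mulVec_le hQ _ x y).trans ?_
      exact mul_le_mul_of_nonneg_left (mul_le_mul (Real.sqrt_le_sqrt (hP 0 x))
        (Real.sqrt_le_sqrt (hP' 0 y)) (Real.sqrt_nonneg _) (Real.sqrt_nonneg _)) (hsum _)
    | succ k ih =>
      intro x y
      rw [hD, Matrix.add_mulVec, dotProduct_add, dotProduct_mulVec_mul_mul, hcs, add_mul]
      refine (abs_add_le _ _).trans (add_le_add ?_ ?_)
      · refine (ih _ _).trans ?_
        have := mul_le_mul (hcontr P F hPβ hF k x) (hcontr P' F' hPβ' hF' k y)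
          (Real.sqrt_nonneg _) (by positivity)
        refine (mul_le_mul_of_nonneg_left this (hc0 k)).trans (le_of_eq ?_)
        have h2 := Real.mul_self_sqrt hρ0
        calc _ = (√(1 - β⁻¹) * √(1 - β⁻¹)) * c k *
              (√(x ⬝ᵥ P (k + 1) *ᵥ x) * √(y ⬝ᵥ P' (k + 1) *ᵥ y)) := by ring
          _ = _ := by rw [h2]
      · refine (abs_dotProduct_mulVec_le hQ _ x y).trans ?_
        exact mul_le_mul_of_nonneg_left (mul_le_mul (Real.sqrt_le_sqrt (hP _ x))
          (Real.sqrt_le_sqrt (hP' _ y)) (Real.sqrt_nonneg _) (Real.sqrt_nonneg _)) (hsum _)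
  have hclim : Tendsto c atTop (𝓝 0) := by
    refine le_of_affine_recursion_tendsto hρ0 hρ1 hc0
      (e := fun k => (∑ a, ∑ b, |E k a b|) * (Q⁻¹).trace) ?_ (fun k => (hcs k).le)
    have hE' := Matrix.tendsto_iff_entries.mp hE
    have : Tendsto (fun k => (∑ a, ∑ b, |E k a b|) * (Q⁻¹).trace) atTop
        (𝓝 ((∑ a : ι, ∑ b : ι, |(0 : Matrix ι ι ℝ) a b|) * (Q⁻¹).trace)) :=
      (tendsto_finsetSum _ fun a _ => tendsto_finsetSum _ fun b _ => (hE' a b).abs).mul_const _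
    simpa using this
  rw [Matrix.tendsto_iff_entries]
  intro a b
  refine squeeze_zero_norm (a := fun k => c k * (√(β * Q a a) * √(β * Q b b))) (fun k => ?_) ?_
  · have h := hmain k (Pi.single a 1) (Pi.single b 1)
    have h1 := hPβ k (Pi.single a 1)
    have h2 := hPβ' k (Pi.single b 1)
    simp only [Matrix.mulVec_single_one, single_one_dotProduct, Matrix.col_apply] at h h1 h2
    rw [Real.norm_eq_abs]
    exact h.trans (mul_le_mul_of_nonneg_left (mul_le_mul (Real.sqrt_le_sqrt h1)
      (Real.sqrt_le_sqrt h2) (Real.sqrt_nonneg _) (Real.sqrt_nonneg _)) (hc0 k))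
  · simpa using hclim.mul_const (√(β * Q a a) * √(β * Q b b))

end Riccati

/-! ### Long-time behaviour of the Riccati recursion -/

section RiccatiLimit

variable {ι : Type*} [Fintype ι] [DecidableEq ι]

theorem exists_forall_le_of_eventually_le {f : ℕ → ℝ} {c : ℝ} (h : ∀ᶠ k in atTop, f k ≤ c) :
    ∃ c', ∀ k, f k ≤ c' := by
  have : IsBoundedUnder (· ≤ ·) atTop f := ⟨c, by simpa using h⟩
  obtain ⟨c', hc'⟩ := this.bddAbove_range
  exact ⟨c', fun k => hc' (Set.mem_range_self k)⟩

omit [DecidableEq ι] in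
theorem Matrix.PosSemidef.dotProduct_add_le {M : Matrix ι ι ℝ} (hM : M.PosSemidef) (x y : ι → ℝ) :
    (x + y) ⬝ᵥ M *ᵥ (x + y) ≤ 2 * (x ⬝ᵥ M *ᵥ x) + 2 * (y ⬝ᵥ M *ᵥ y) := by
  have := hM.dotProduct_nonneg (x - y)
  simp only [Matrix.mulVec_add, Matrix.mulVec_sub, add_dotProduct, dotProduct_add,
    sub_dotProduct, dotProduct_sub] at this ⊢
  linarith

/-- Observability of `(A, G)`, for symmetric `G`, in dual form. -/
theorem exists_sum_transpose_pow_mulVec {A G : Matrix ι ι ℝ} {m : ℕ}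
    (hG : Gᵀ = G) (hobs : ∀ x : ι → ℝ, (∀ k < m, (G * A ^ k) *ᵥ x = 0) → x = 0) (y : ι → ℝ) :
    ∃ g : ℕ → ι → ℝ, y = ∑ k ∈ Finset.range m, (Aᵀ) ^ k *ᵥ (G *ᵥ g k) := by
  -- The observability Gramian. Its quadratic form is `∑ |G Aᵏ x|²`, so observability makes it
  -- invertible, and solving `O z = y` gives the vectors `g k = G Aᵏ z`.
  set O : Matrix ι ι ℝ := ∑ k ∈ Finset.range m, (G * A ^ k)ᵀ * (G * A ^ k) with hO
  have hinj : Function.Injective O.mulVec := by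
    rw [← Matrix.coe_mulVecLin, ← LinearMap.ker_eq_bot, LinearMap.ker_eq_bot']
    intro x hx
    rw [Matrix.mulVecLin_apply] at hx
    have h0 : ∑ k ∈ Finset.range m, ((G * A ^ k) *ᵥ x) ⬝ᵥ ((G * A ^ k) *ᵥ x) = 0 := by
      have := congrArg (x ⬝ᵥ ·) hx
      simp only [hO, Matrix.sum_mulVec, dotProduct_sum, dotProduct_zero] at this
      rw [← this]
      refine Finset.sum_congr rfl fun k _ => ?_
      rw [← Matrix.mulVec_mulVec x ((G * A ^ k)ᵀ),
        Matrix.mulVec_transpose, dotProduct_comm x, ← Matrix.dotProduct_mulVec]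
    refine hobs x fun k hk => ?_
    rw [Finset.sum_eq_zero_iff_of_nonneg (fun k _ => by
      simpa using dotProduct_star_self_nonneg ((G * A ^ k) *ᵥ x))] at h0
    exact dotProduct_self_eq_zero.mp (h0 k (Finset.mem_range.mpr hk))
  have hsurj : Function.Surjective O.mulVec :=
    Matrix.mulVec_surjective_iff_isUnit.mpr (Matrix.mulVec_injective_iff_isUnit.mp hinj)
  obtain ⟨z, hz⟩ := hsurj y
  refine ⟨fun k => (G * A ^ k) *ᵥ z, ?_⟩
  rw [← hz, hO, Matrix.sum_mulVec]
  refine Finset.sum_congr rfl fun k _ => ?_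
  rw [transpose_mul, hG, transpose_pow, Matrix.mul_assoc, ← Matrix.mulVec_mulVec,
    ← Matrix.mulVec_mulVec]

/-- Data of a Riccati recursion `P (k+1) = A ((P k)⁻¹ + G k)⁻¹ Aᵀ + Q` whose information matrices
converge to `H`, with kernels containing the kernel of `H`. -/
structure RiccatiRun (A Q H : Matrix ι ι ℝ) (P G : ℕ → Matrix ι ι ℝ) : Prop where
  Q_pos : Q.PosDef
  init_pos : (P 0).PosDef
  H_nonneg : H.PosSemidef
  G_nonneg : ∀ k, (G k).PosSemidef
  step : ∀ k, P (k + 1) = riccatiStep A Q (P k) (G k)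
  ker : ∀ k x, H *ᵥ x = 0 → G k *ᵥ x = 0
  lim : Tendsto G atTop (𝓝 H)

namespace RiccatiRun

variable {A Q H : Matrix ι ι ℝ} {P G : ℕ → Matrix ι ι ℝ}

theorem posDef (h : RiccatiRun A Q H P G) (k : ℕ) : (P k).PosDef := by
  induction k with
  | zero => exact h.init_pos
  | succ k ih => rw [h.step]; exact riccatiStep_posDef h.Q_pos ih (h.G_nonneg k)

theorem shift (h : RiccatiRun A Q H P G) : RiccatiRun A Q H (fun k => P (k + 1))
    (fun k => G (k + 1)) where
  Q_pos := h.Q_pos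
  init_pos := h.posDef 1
  H_nonneg := h.H_nonneg
  G_nonneg _ := h.G_nonneg _
  step _ := h.step _
  ker _ := h.ker _
  lim := h.lim.comp (tendsto_add_atTop_nat 1)

/-- One step replaces the form of `P` at `y` by that of `Φ` at `Aᵀ y`. A component of `Aᵀ y` in the
range of `H` costs only a bounded amount and can be removed; on the rest `Φ ≤ P`, and the argument
repeats. Observability ensures that nothing is left after `m` steps. -/
theorem exists_bound_vec (h : RiccatiRun A Q H P G) {m : ℕ}
    (hobs : ∀ x : ι → ℝ, (∀ k < m, (H * A ^ k) *ᵥ x = 0) → x = 0) (y : ι → ℝ) :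
    ∃ c, ∀ k, y ⬝ᵥ P k *ᵥ y ≤ c := by
  have hΦ : ∀ k, (infoUpdate (P k) (G k)).PosSemidef := fun k =>
    (infoUpdate_posDef (h.posDef k) (h.G_nonneg k)).posSemidef
  have hHT := h.H_nonneg.transpose_eq
  have hback : ∀ y : ι → ℝ, (∃ c, ∀ k, (Aᵀ *ᵥ y) ⬝ᵥ infoUpdate (P k) (G k) *ᵥ (Aᵀ *ᵥ y) ≤ c) →
      ∃ c, ∀ k, y ⬝ᵥ P k *ᵥ y ≤ c := by
    rintro y ⟨c, hc⟩
    refine ⟨max (y ⬝ᵥ P 0 *ᵥ y) (c + y ⬝ᵥ Q *ᵥ y), fun k => ?_⟩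
    cases k with
    | zero => exact le_max_left _ _
    | succ k =>
      refine le_max_of_le_right ?_
      rw [h.step, dotProduct_riccatiStep]
      linarith [hc k]
  -- Eventually `G k` has the same range projection as `H`, so `H z = G k (G k)† H z`; apply
  -- `dotProduct_infoUpdate_range_le` to `(G k)† H z`, which converges.
  have hrange : ∀ z : ι → ℝ, ∃ c, ∀ k,
      (H *ᵥ z) ⬝ᵥ infoUpdate (P k) (G k) *ᵥ (H *ᵥ z) ≤ c := by
    intro z
    obtain ⟨hlim, heq⟩ := tendsto_pinv hHT (fun k => (h.G_nonneg k).transpose_eq) h.ker h.lim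
    have hb : Tendsto (fun k => z ⬝ᵥ ((pinv (G k) * H)ᵀ * G k * (pinv (G k) * H)) *ᵥ z) atTop
        (𝓝 (z ⬝ᵥ ((pinv H * H)ᵀ * H * (pinv H * H)) *ᵥ z)) := by
      have h1 := hlim.mul_const H
      have h2 := ((continuous_id.matrix_transpose).tendsto _).comp h1
      exact Matrix.tendsto_dotProduct_mulVec ((h2.mul h.lim).mul h1) z z
    obtain ⟨c, hc⟩ := exists_forall_le_of_eventually_le
      (hb.eventually (ge_mem_nhds (lt_add_one _)))
    refine exists_forall_le_of_eventually_le (c := c) (heq.mono fun k hk => ?_)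
    have h3 : H *ᵥ z = G k *ᵥ ((pinv (G k) * H) *ᵥ z) := by
      rw [Matrix.mulVec_mulVec, ← Matrix.mul_assoc,
        mul_pinv_comm_of_symm (h.G_nonneg k).transpose_eq, hk, ← mul_pinv_comm_of_symm hHT,
        (pinv_spec H).mul_mul_self]
    have h4 := dotProduct_infoUpdate_range_le (h.posDef k) (h.G_nonneg k)
      ((pinv (G k) * H) *ᵥ z)
    rw [← h3] at h4
    have h5 := dotProduct_mulVec_mul_mul (pinv (G k) * H)ᵀ (G k) (pinv (G k) * H)ᵀ z z
    rw [transpose_transpose] at h5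
    exact h4.trans (h3 ▸ h5 ▸ hc k)
  -- Removing `H (g m)` from `Aᵀ y` shortens the expansion by its top term.
  have hind : ∀ (m : ℕ) (y : ι → ℝ) (g : ℕ → ι → ℝ),
      (Aᵀ) ^ m *ᵥ y = ∑ k ∈ Finset.range m, (Aᵀ) ^ k *ᵥ (H *ᵥ g k) →
      ∃ c, ∀ k, y ⬝ᵥ P k *ᵥ y ≤ c := by
    intro m
    induction m with
    | zero =>
      intro y g hy
      have hy0 : y = 0 := by simpa using hy
      exact ⟨0, fun k => by simp [hy0]⟩
    | succ m ih =>
      intro y g hy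
      have h1 : (Aᵀ) ^ m *ᵥ (Aᵀ *ᵥ y - H *ᵥ g m) =
          ∑ k ∈ Finset.range m, (Aᵀ) ^ k *ᵥ (H *ᵥ g k) := by
        rw [Matrix.mulVec_sub, Matrix.mulVec_mulVec, ← pow_succ, hy, Finset.sum_range_succ,
          add_sub_cancel_right]
      obtain ⟨c₁, hc₁⟩ := ih _ g h1
      obtain ⟨c₂, hc₂⟩ := hrange (g m)
      refine hback y ⟨2 * c₁ + 2 * c₂, fun k => ?_⟩
      have h2 := (hΦ k).dotProduct_add_le (Aᵀ *ᵥ y - H *ᵥ g m) (H *ᵥ g m)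
      rw [sub_add_cancel] at h2
      have h3 := dotProduct_infoUpdate_le (h.posDef k) (h.G_nonneg k) (Aᵀ *ᵥ y - H *ᵥ g m)
      linarith [hc₁ k, hc₂ k]
  -- The expansion is taken for `(Aᵀ)ᵐ y`, not for `y`, so `A` may be singular.
  obtain ⟨g, hg⟩ := exists_sum_transpose_pow_mulVec hHT hobs ((Aᵀ) ^ m *ᵥ y)
  exact hind m y g hg

theorem exists_bound_entries (h : RiccatiRun A Q H P G) {m : ℕ}
    (hobs : ∀ x : ι → ℝ, (∀ k < m, (H * A ^ k) *ᵥ x = 0) → x = 0) :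
    ∃ K, ∀ k a b, |P k a b| ≤ K := by
  choose c hc using h.exists_bound_vec hobs
  have hd : ∀ k a, P k a a ≤ ∑ i, |c (Pi.single i 1)| := by
    intro k a
    have := hc (Pi.single a 1) k
    rw [Matrix.mulVec_single_one, single_one_dotProduct, Matrix.col_apply] at this
    exact this.trans ((le_abs_self _).trans
      (Finset.single_le_sum (f := fun i => |c (Pi.single i 1)|) (fun i _ => abs_nonneg _)
        (Finset.mem_univ a)))
  refine ⟨∑ i, |c (Pi.single i 1)|, fun k a b => ?_⟩
  have hcs := (h.posDef k).posSemidef.sq_dotProduct_le (Pi.single a 1) (Pi.single b 1)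
  simp only [Matrix.mulVec_single_one, single_one_dotProduct, Matrix.col_apply] at hcs
  refine abs_le_of_sq_le_sq ?_ (Finset.sum_nonneg fun i _ => abs_nonneg _)
  refine hcs.trans ?_
  rw [sq]
  exact mul_le_mul (hd k a) (hd k b) ((h.posDef k).posSemidef.diag_nonneg)
    (Finset.sum_nonneg fun i _ => abs_nonneg _)

theorem exists_bound (h : RiccatiRun A Q H P G) {m : ℕ}
    (hobs : ∀ x : ι → ℝ, (∀ k < m, (H * A ^ k) *ᵥ x = 0) → x = 0) :
    ∃ β, ∀ k x, x ⬝ᵥ P k *ᵥ x ≤ β * (x ⬝ᵥ Q *ᵥ x) := by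
  obtain ⟨K, hK⟩ := h.exists_bound_entries hobs
  refine ⟨(∑ _a : ι, ∑ _b : ι, K) * (Q⁻¹).trace, fun k x => ?_⟩
  have h1 := (le_abs_self _).trans (abs_dotProduct_mulVec_le h.Q_pos (P k) x x)
  have hq := h.Q_pos.posSemidef.dotProduct_nonneg x
  rw [Real.mul_self_sqrt hq] at h1
  refine h1.trans (mul_le_mul_of_nonneg_right (mul_le_mul_of_nonneg_right ?_
    h.Q_pos.inv.posSemidef.trace_nonneg) hq)
  exact Finset.sum_le_sum fun a _ => Finset.sum_le_sum fun b _ => hK k a b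

/-- `Φ ≤ P` bounds the diagonal and Cauchy-Schwarz the other entries. Needed so that forcing terms
such as `Φ (G' - G) Φ'` vanish with `G' - G`. -/
theorem infoUpdate_bound (h : RiccatiRun A Q H P G) {m : ℕ}
    (hobs : ∀ x : ι → ℝ, (∀ k < m, (H * A ^ k) *ᵥ x = 0) → x = 0) :
    ∃ K, ∀ k a b, |infoUpdate (P k) (G k) a b| ≤ K := by
  obtain ⟨K, hK⟩ := h.exists_bound_entries hobs
  refine ⟨K, fun k a b => ?_⟩
  have hΦ := (infoUpdate_posDef (h.posDef k) (h.G_nonneg k)).posSemidef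
  have hd : ∀ a, infoUpdate (P k) (G k) a a ≤ K := by
    intro a
    have := dotProduct_infoUpdate_le (h.posDef k) (h.G_nonneg k) (Pi.single a 1)
    simp only [Matrix.mulVec_single_one, single_one_dotProduct, Matrix.col_apply] at this
    exact this.trans ((le_abs_self _).trans (hK k a a))
  have hcs := hΦ.sq_dotProduct_le (Pi.single a 1) (Pi.single b 1)
  simp only [Matrix.mulVec_single_one, single_one_dotProduct, Matrix.col_apply] at hcs
  have hK0 : 0 ≤ K := (abs_nonneg _).trans (hK k a b)
  refine abs_le_of_sq_le_sq (hcs.trans ?_) hK0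
  rw [sq]
  exact mul_le_mul (hd a) (hd b) hΦ.diag_nonneg hK0

end RiccatiRun

omit [DecidableEq ι] in
theorem Matrix.tendsto_bdd_mul_zero {X E : ℕ → Matrix ι ι ℝ} {K : ℝ} (hX : ∀ k a b, |X k a b| ≤ K)
    (hE : Tendsto E atTop (𝓝 0)) : Tendsto (fun k => X k * E k) atTop (𝓝 0) := by
  rw [Matrix.tendsto_iff_entries] at hE ⊢
  intro a b
  simp only [Matrix.mul_apply, Matrix.zero_apply] at hE ⊢
  rw [show (0 : ℝ) = ∑ _c : ι, 0 by simp]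
  refine tendsto_finsetSum _ fun c _ => ?_
  refine squeeze_zero_norm (a := fun k => K * |E k c b|) (fun k => ?_) ?_
  · rw [norm_mul, Real.norm_eq_abs, Real.norm_eq_abs]
    exact mul_le_mul_of_nonneg_right (hX k a c) (abs_nonneg _)
  · simpa using (hE c b).abs.const_mul K

omit [DecidableEq ι] in
theorem Matrix.tendsto_zero_mul_bdd {X E : ℕ → Matrix ι ι ℝ} {K : ℝ} (hX : ∀ k a b, |X k a b| ≤ K)
    (hE : Tendsto E atTop (𝓝 0)) : Tendsto (fun k => E k * X k) atTop (𝓝 0) := by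
  have h1 : Tendsto (fun k => (E k)ᵀ) atTop (𝓝 0) := by
    rw [Matrix.tendsto_iff_entries] at hE ⊢
    exact fun a b => hE b a
  have h2 := Matrix.tendsto_bdd_mul_zero (X := fun k => (X k)ᵀ) (fun k a b => hX k b a) h1
  rw [Matrix.tendsto_iff_entries] at h2 ⊢
  intro a b
  simpa [← transpose_mul] using h2 b a

/-- Two runs of the Riccati recursion with the same limit of the information matrices merge. -/
theorem RiccatiRun.tendsto_sub {A Q H : Matrix ι ι ℝ} {P G P' G' : ℕ → Matrix ι ι ℝ}
    (h : RiccatiRun A Q H P G) (h' : RiccatiRun A Q H P' G') {m : ℕ}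
    (hobs : ∀ x : ι → ℝ, (∀ k < m, (H * A ^ k) *ᵥ x = 0) → x = 0) :
    Tendsto (fun k => P k - P' k) atTop (𝓝 0) := by
  obtain ⟨β, hβ⟩ := h.exists_bound hobs
  obtain ⟨β', hβ'⟩ := h'.exists_bound hobs
  obtain ⟨K, hK⟩ := h.infoUpdate_bound hobs
  obtain ⟨K', hK'⟩ := h'.infoUpdate_bound hobs
  have hq : ∀ x : ι → ℝ, 0 ≤ x ⬝ᵥ Q *ᵥ x := h.Q_pos.posSemidef.dotProduct_nonneg
  -- The initial covariances need not dominate `Q`; all later ones do.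
  rw [← tendsto_add_atTop_iff_nat 1]
  refine tendsto_zero_of_contraction h.Q_pos (β := max 1 (max β β')) (le_max_left _ _)
    (P := fun k => P (k + 1)) (P' := fun k => P' (k + 1))
    (F := fun k => errorGain A (P (k + 1)) (G (k + 1)))
    (F' := fun k => errorGain A (P' (k + 1)) (G' (k + 1)))
    (E := fun k => A * infoUpdate (P (k + 1)) (G (k + 1)) * (G' (k + 1) - G (k + 1)) *
      (infoUpdate (P' (k + 1)) (G' (k + 1)) * Aᵀ))
    (fun k x => ?_) (fun k x => ?_) (fun k x => ?_) (fun k x => ?_) (fun k x => ?_)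
    (fun k x => ?_) (fun k => ?_) ?_
  · rw [h.step]; exact le_dotProduct_riccatiStep (h.posDef k) (h.G_nonneg k) x
  · rw [h'.step]; exact le_dotProduct_riccatiStep (h'.posDef k) (h'.G_nonneg k) x
  · exact (hβ _ x).trans (mul_le_mul_of_nonneg_right
      ((le_max_left _ _).trans (le_max_right _ _)) (hq x))
  · exact (hβ' _ x).trans (mul_le_mul_of_nonneg_right
      ((le_max_right _ _).trans (le_max_right _ _)) (hq x))
  · rw [h.step (k + 1)]; exact errorGain_contraction (h.posDef _) (h.G_nonneg _) x
  · rw [h'.step (k + 1)]; exact errorGain_contraction (h'.posDef _) (h'.G_nonneg _) x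
  · rw [h.step (k + 1), h'.step (k + 1)]
    exact riccatiStep_sub_riccatiStep (h.posDef _) (h.G_nonneg _) (h'.posDef _) (h'.G_nonneg _)
  · have h1 : Tendsto (fun k => G' (k + 1) - G (k + 1)) atTop (𝓝 0) := by
      simpa using h'.shift.lim.sub h.shift.lim
    have h2 := Matrix.tendsto_zero_mul_bdd (fun k => hK' (k + 1))
      (Matrix.tendsto_bdd_mul_zero (fun k => hK (k + 1)) h1)
    simpa [Matrix.mul_assoc] using (h2.const_mul A).mul_const Aᵀ

theorem tendsto_riccatiStep {A Q H M : Matrix ι ι ℝ} {f : ℕ → Matrix ι ι ℝ} (hM : M.PosDef)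
    (hH : H.PosSemidef) (hf : Tendsto f atTop (𝓝 M)) :
    Tendsto (fun k => riccatiStep A Q (f k) H) atTop (𝓝 (riccatiStep A Q M H)) := by
  have h1 := (Matrix.tendsto_inv hM.isUnit_det hf).add_const H
  have h2 := Matrix.tendsto_inv (hM.inv.add_posSemidef hH).isUnit_det h1
  exact ((h2.const_mul A).mul_const Aᵀ).add_const Q

/-- Existence, uniqueness and attractivity of the positive definite solution of the discrete
algebraic Riccati equation, for observable pairs and positive definite `Q`. -/
theorem exists_riccati_fixed {A Q H : Matrix ι ι ℝ} (hQ : Q.PosDef) (hH : H.PosSemidef) {m : ℕ}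
    (hobs : ∀ x : ι → ℝ, (∀ k < m, (H * A ^ k) *ᵥ x = 0) → x = 0) :
    ∃ R : Matrix ι ι ℝ, (R.PosDef ∧ R = riccatiStep A Q R H) ∧
      (∀ R', R'.PosDef → R' = riccatiStep A Q R' H → R' = R) ∧
      ∀ P G, RiccatiRun A Q H P G → Tendsto P atTop (𝓝 R) := by
  have hconst : ∀ R : Matrix ι ι ℝ, R.PosDef → R = riccatiStep A Q R H →
      RiccatiRun A Q H (fun _ => R) (fun _ => H) := fun R hR h =>
    ⟨hQ, hR, hH, fun _ => hH, fun _ => h, fun _ _ hx => hx, tendsto_const_nhds⟩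
  obtain ⟨R, hR, hRf⟩ : ∃ R : Matrix ι ι ℝ, R.PosDef ∧ R = riccatiStep A Q R H := by
    set P : ℕ → Matrix ι ι ℝ := fun k => (fun M => riccatiStep A Q M H)^[k] Q with hP
    have hrun : RiccatiRun A Q H P (fun _ => H) :=
      ⟨hQ, hQ, hH, fun _ => hH, fun k => Function.iterate_succ_apply' _ k _, fun _ _ hx => hx,
        tendsto_const_nhds⟩
    obtain ⟨K, hK⟩ := hrun.exists_bound_entries hobs
    have hcomp : IsCompact (Set.univ.pi fun _ : ι => Set.univ.pi fun _ : ι => Set.Icc (-K) K) :=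
      isCompact_univ_pi fun _ => isCompact_univ_pi fun _ => isCompact_Icc
    obtain ⟨R, φ, hφ, hlim⟩ : ∃ (R : Matrix ι ι ℝ) (φ : ℕ → ℕ), StrictMono φ ∧
        Tendsto (fun k => P (φ k)) atTop (𝓝 R) := by
      obtain ⟨R, -, φ, hφ, hlim⟩ :=
        IsCompact.tendsto_subseq (X := ι → ι → ℝ) hcomp (x := P) fun k =>
          Set.mem_univ_pi.mpr fun a => Set.mem_univ_pi.mpr fun b => abs_le.mp (hK k a b)
      exact ⟨R, φ, hφ, hlim⟩
    -- The run merges with its own shift, so consecutive terms have the same limit along the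
    -- subsequence, and that limit is a fixed point.
    have hdiff := (hrun.tendsto_sub hrun.shift hobs).comp hφ.tendsto_atTop
    have hlim1 : Tendsto (fun k => P (φ k + 1)) atTop (𝓝 R) := by
      simpa [Function.comp_def] using hlim.sub hdiff
    have hRpos : Matrix.PosDef R := by
      refine Matrix.PosDef.of_dotProduct_mulVec_pos ?_ fun {x} hx => ?_
      · rw [Matrix.IsHermitian, Matrix.conjTranspose_eq_transpose_of_trivial]
        have h1 := ((continuous_id.matrix_transpose).tendsto _).comp hlim
        refine tendsto_nhds_unique h1 (hlim.congr fun k => ?_)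
        exact ((hrun.posDef (φ k)).transpose_eq).symm
      · rw [star_trivial]
        refine (hQ.dotProduct_pos hx).trans_le (ge_of_tendsto'
          (Matrix.tendsto_dotProduct_mulVec hlim1 x x) fun k => ?_)
        rw [hrun.step]
        exact le_dotProduct_riccatiStep (hrun.posDef _) hH x
    refine ⟨R, hRpos, tendsto_nhds_unique hlim1 ?_⟩
    refine (tendsto_riccatiStep hRpos hH hlim).congr fun k => (hrun.step (φ k)).symm
  refine ⟨R, ⟨hR, hRf⟩, fun R' hR' hf' => ?_, fun P G h => ?_⟩
  · have := (hconst R' hR' hf').tendsto_sub (hconst R hR hRf) hobs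
    exact sub_eq_zero.mp (tendsto_nhds_unique tendsto_const_nhds this)
  · simpa using (h.tendsto_sub (hconst R hR hRf) hobs).add_const R

/-- The true covariance of a filter that runs on convergent approximate information matrices has
the same limit as the covariance that the filter computes. -/
theorem RiccatiRun.tendsto_true_sub {A Q H : Matrix ι ι ℝ} {P G S M : ℕ → Matrix ι ι ℝ}
    (h : RiccatiRun A Q H P G) {m : ℕ}
    (hobs : ∀ x : ι → ℝ, (∀ k < m, (H * A ^ k) *ᵥ x = 0) → x = 0)
    (hM : Tendsto M atTop (𝓝 H))
    (hS : ∀ k, S (k + 1) = errorGain A (P k) (G k) * S k * (errorGain A (P k) (G k))ᵀ +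
      A * infoUpdate (P k) (G k) * M k * (infoUpdate (P k) (G k) * Aᵀ) + Q) :
    Tendsto (fun k => S k - P k) atTop (𝓝 0) := by
  obtain ⟨β, hβ⟩ := h.exists_bound hobs
  obtain ⟨K, hK⟩ := h.infoUpdate_bound hobs
  have hq : ∀ x : ι → ℝ, 0 ≤ x ⬝ᵥ Q *ᵥ x := h.Q_pos.posSemidef.dotProduct_nonneg
  -- The computed covariance in Joseph form has the shape of `hS` with `G` for `M`, so the
  -- difference is forced only by `M - G`.
  have hP : ∀ k, P (k + 1) = errorGain A (P k) (G k) * P k * (errorGain A (P k) (G k))ᵀ +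
      A * infoUpdate (P k) (G k) * G k * (infoUpdate (P k) (G k) * Aᵀ) + Q := by
    intro k
    rw [h.step, riccatiStep]
    conv_lhs => rw [infoUpdate_eq (h.posDef k) (h.G_nonneg k)]
    rw [errorGain_transpose (h.posDef k) (h.G_nonneg k), errorGain]
    congr 1
    have : A * infoUpdate (P k) (G k) * (P k)⁻¹ * P k * ((P k)⁻¹ * infoUpdate (P k) (G k) * Aᵀ) =
        A * infoUpdate (P k) (G k) * (((P k)⁻¹ * P k) * (P k)⁻¹) * infoUpdate (P k) (G k) * Aᵀ := by
      noncomm_ring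
    rw [this, Matrix.nonsing_inv_mul _ (h.posDef k).isUnit_det, Matrix.one_mul]
    noncomm_ring
  rw [← tendsto_add_atTop_iff_nat 1]
  have hcon : ∀ k x, ((errorGain A (P (k + 1)) (G (k + 1)))ᵀ *ᵥ x) ⬝ᵥ P (k + 1) *ᵥ
      ((errorGain A (P (k + 1)) (G (k + 1)))ᵀ *ᵥ x) + x ⬝ᵥ Q *ᵥ x ≤ x ⬝ᵥ P (k + 1 + 1) *ᵥ x :=
    fun k x => by
      rw [h.step (k + 1)]; exact errorGain_contraction (h.posDef _) (h.G_nonneg _) x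
  have hlow : ∀ k x, x ⬝ᵥ Q *ᵥ x ≤ x ⬝ᵥ P (k + 1) *ᵥ x := fun k x => by
    rw [h.step]; exact le_dotProduct_riccatiStep (h.posDef k) (h.G_nonneg k) x
  have hup : ∀ k x, x ⬝ᵥ P (k + 1) *ᵥ x ≤ max 1 β * (x ⬝ᵥ Q *ᵥ x) := fun k x =>
    (hβ _ x).trans (mul_le_mul_of_nonneg_right (le_max_right _ _) (hq x))
  refine tendsto_zero_of_contraction h.Q_pos (β := max 1 β) (le_max_left _ _)
    (P := fun k => P (k + 1)) (P' := fun k => P (k + 1))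
    (F := fun k => errorGain A (P (k + 1)) (G (k + 1)))
    (F' := fun k => errorGain A (P (k + 1)) (G (k + 1)))
    (E := fun k => A * infoUpdate (P (k + 1)) (G (k + 1)) * (M (k + 1) - G (k + 1)) *
      (infoUpdate (P (k + 1)) (G (k + 1)) * Aᵀ)) hlow hlow hup hup hcon hcon (fun k => ?_) ?_
  · rw [hS (k + 1), hP (k + 1)]
    noncomm_ring
  · have h1 : Tendsto (fun k => M (k + 1) - G (k + 1)) atTop (𝓝 0) := by
      simpa using (hM.comp (tendsto_add_atTop_nat 1)).sub h.shift.lim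
    have h2 := Matrix.tendsto_zero_mul_bdd (fun k => hK (k + 1))
      (Matrix.tendsto_bdd_mul_zero (fun k => hK (k + 1)) h1)
    simpa [Matrix.mul_assoc] using (h2.const_mul A).mul_const Aᵀ

end RiccatiLimit

/-! ### Convergence of doubly stochastic powers to the average -/

section Consensus

variable {N : ℕ} {L : Matrix (Fin N) (Fin N) ℝ} {G : SimpleGraph (Fin N)}

theorem mul_le_pow_succ_apply (hL : L ∈ doublyStochastic ℝ (Fin N)) (m : ℕ) (i k j : Fin N) :
    L i k * (L ^ m) k j ≤ (L ^ (m + 1)) i j := by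
  rw [pow_succ', Matrix.mul_apply]
  exact Finset.single_le_sum (f := fun k => L i k * (L ^ m) k j)
    (fun k _ => mul_nonneg (nonneg_of_mem_doublyStochastic hL)
      (nonneg_of_mem_doublyStochastic (pow_mem hL m))) (Finset.mem_univ k)

/-- Connectivity and positive diagonal weights make the weight matrix primitive. -/
theorem exists_pow_pos (hL : L ∈ doublyStochastic ℝ (Fin N)) (hdiag : ∀ i, 0 < L i i)
    (hadj : ∀ i j, G.Adj i j → 0 < L i j) (hconn : G.Connected) :
    ∃ m, 0 < m ∧ ∀ i j, 0 < (L ^ m) i j := by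
  have hwalk : ∀ i j, ∃ m, ∀ m', m ≤ m' → 0 < (L ^ m') i j := by
    intro i j
    obtain ⟨p⟩ := hconn.preconnected i j
    induction p with
    | nil =>
      refine ⟨0, fun m hm => ?_⟩
      clear hm
      induction m with
      | zero => simp
      | succ m ih =>
        exact (mul_pos (hdiag _) ih).trans_le (mul_le_pow_succ_apply hL _ _ _ _)
    | cons h p ih =>
      obtain ⟨m, hm⟩ := ih
      refine ⟨m + 1, fun m' hm' => ?_⟩
      obtain ⟨m', rfl⟩ := Nat.exists_eq_add_of_le' hm'
      exact (mul_pos (hadj _ _ h) (hm (m' + m) (by omega))).trans_le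
        (mul_le_pow_succ_apply hL _ _ _ _)
  choose m hm using hwalk
  refine ⟨(∑ i, ∑ j, m i j) + 1, Nat.succ_pos _, fun i j => hm i j _ ?_⟩
  have h1 : m i j ≤ ∑ j, m i j := Finset.single_le_sum (fun _ _ => Nat.zero_le _) (Finset.mem_univ j)
  have h2 : ∑ j, m i j ≤ ∑ i, ∑ j, m i j :=
    Finset.single_le_sum (f := fun i => ∑ j, m i j) (fun _ _ => Nat.zero_le _) (Finset.mem_univ i)
  omega

/-- Consensus: the powers of the weight matrix of a connected graph converge to the average. -/
theorem tendsto_pow_doublyStochastic (hL : L ∈ doublyStochastic ℝ (Fin N))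
    (hdiag : ∀ i, 0 < L i i) (hadj : ∀ i j, G.Adj i j → 0 < L i j) (hconn : G.Connected)
    (i j : Fin N) : Tendsto (fun k => (L ^ k) i j) atTop (𝓝 (N : ℝ)⁻¹) := by
  obtain ⟨m, hm0, hm⟩ := exists_pow_pos hL hdiag hadj hconn
  have : Nonempty (Fin N × Fin N) := ⟨(i, j)⟩
  obtain ⟨p, hp⟩ := Finite.exists_min fun p : Fin N × Fin N => (L ^ m) p.1 p.2
  set ε := (L ^ m) p.1 p.2 with hε
  have hN0 : 0 < N := i.pos
  have hN : (0 : ℝ) < N := Nat.cast_pos.mpr hN0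
  have hN1 : (N : ℝ)⁻¹ ≤ 1 := inv_le_one_of_one_le₀ (by exact_mod_cast hN0)
  have hLm := pow_mem hL m
  have hsum : ∀ i, ∑ l, ((L ^ m) i l - ε) = 1 - N * ε := fun i => by
    rw [Finset.sum_sub_distrib, sum_row_of_mem_doublyStochastic hLm]
    simp
  have hge : ∀ i l, 0 ≤ (L ^ m) i l - ε := fun i l => sub_nonneg.mpr (hp (i, l))
  have hρ0 : 0 ≤ 1 - N * ε := by
    rw [← hsum i]; exact Finset.sum_nonneg fun l _ => hge i l
  have hρ1 : 1 - N * ε < 1 := by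
    have := mul_pos hN (hm p.1 p.2)
    linarith
  have hbound : ∀ t r i, |(L ^ (m * t + r)) i j - (N : ℝ)⁻¹| ≤ (1 - N * ε) ^ t := by
    intro t r
    induction t with
    | zero =>
      intro i
      have h1 := nonneg_of_mem_doublyStochastic (pow_mem hL (m * 0 + r)) (i := i) (j := j)
      have h2 := le_one_of_mem_doublyStochastic (pow_mem hL (m * 0 + r)) (i := i) (j := j)
      have h3 := inv_pos.mpr hN
      rw [pow_zero, abs_le]
      constructor <;> linarith
    | succ t ih =>
      intro i
      have hcol := sum_col_of_mem_doublyStochastic (pow_mem hL (m * t + r)) j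
      -- Doeblin's argument: columns sum to one, so the deviations from `1 / N` sum to zero over
      -- `l`, and the minimal entry `ε` may be subtracted from the weights. The reduced weights are
      -- nonnegative with row sum `1 - N ε`.
      have h1 : (L ^ (m * (t + 1) + r)) i j - (N : ℝ)⁻¹ =
          ∑ l, ((L ^ m) i l - ε) * ((L ^ (m * t + r)) l j - (N : ℝ)⁻¹) := by
        have : m * (t + 1) + r = m + (m * t + r) := by ring
        rw [this, pow_add, Matrix.mul_apply]
        simp only [sub_mul, mul_sub, Finset.sum_sub_distrib, ← Finset.mul_sum, ← Finset.sum_mul,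
          sum_row_of_mem_doublyStochastic hLm, hcol]
        simp [mul_inv_cancel₀ hN.ne']
      rw [h1]
      refine (Finset.abs_sum_le_sum_abs _ _).trans ?_
      have h2 : (1 - N * ε) ^ (t + 1) = ∑ l, ((L ^ m) i l - ε) * (1 - N * ε) ^ t := by
        rw [← Finset.sum_mul, hsum, pow_succ']
      rw [h2]
      refine Finset.sum_le_sum fun l _ => ?_
      rw [abs_mul, abs_of_nonneg (hge i l)]
      exact mul_le_mul_of_nonneg_left (ih l) (hge i l)
  rw [tendsto_iff_norm_sub_tendsto_zero]
  refine squeeze_zero (fun _ => norm_nonneg _) (g := fun k => (1 - N * ε) ^ (k / m))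
    (fun k => ?_) ?_
  · have := hbound (k / m) (k % m) i
    rwa [Nat.div_add_mod] at this
  · exact (tendsto_pow_atTop_nhds_zero_of_lt_one hρ0 hρ1).comp
      (Nat.tendsto_div_const_atTop hm0.ne')

end Consensus

theorem tendsto_pinv_of_isUnit {ι α : Type*} [Fintype ι] [DecidableEq ι] {l : Filter α}
    {f : α → Matrix ι ι ℝ} {M : Matrix ι ι ℝ} (hM : IsUnit M.det) (hf : Tendsto f l (𝓝 M)) :
    Tendsto (fun k => pinv (f k)) l (𝓝 M⁻¹) :=
  (Matrix.tendsto_inv hM hf).congr'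
    ((Matrix.eventually_isUnit_det hM hf).mono fun _ hk => (pinv_eq_inv hk).symm)

/-! ### Fused quantities and the direct estimate -/

namespace SensorNetwork

variable {N n : ℕ} (S : SensorNetwork N n)

theorem consensusStep_iterate {V : Type*} [AddCommMonoid V] [Module ℝ V] (Z : Fin N → V) (m : ℕ)
    (i : Fin N) : (S.consensusStep^[m] Z) i = ∑ j, (S.L ^ m) i j • Z j := by
  induction m generalizing i with
  | zero => simp [Matrix.one_apply]
  | succ m ih =>
    rw [Function.iterate_succ_apply', consensusStep, pow_succ']
    simp only [ih, Finset.smul_sum, smul_smul, Matrix.mul_apply, Finset.sum_smul]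
    exact Finset.sum_comm

theorem fuse_apply {V : Type*} [AddCommMonoid V] [Module ℝ V] (Z : Fin N → V) (i : Fin N) :
    S.fuse Z i = ∑ j, (S.L ^ S.γ) i j • Z j :=
  S.consensusStep_iterate Z S.γ i

/-- The weights pass through `k γ` consensus steps by time `k`, so they reach the average, while the
factor `ũ i` sees only `γ` steps and keeps the entries of `L ^ γ`. -/
theorem directWeight_eq (q : Fin N → Fin N → ℝ) (k : ℕ) (i : Fin N) :
    S.directWeight q k i =
      ∑ j, ((S.L ^ S.γ) ^ k) i j • (N : ℝ) • Matrix.vecMulVec (q j) (q j) := by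
  induction k generalizing i with
  | zero => simp [directWeight, Matrix.one_apply]
  | succ k ih =>
    rw [directWeight, fuse_apply, pow_succ']
    simp only [ih, Finset.smul_sum, Matrix.mul_apply, Finset.sum_smul]
    rw [Finset.sum_comm]
    simp only [smul_smul, mul_assoc]

theorem directFactor_apply (q : Fin N → Fin N → ℝ) (i : Fin N) (a : Fin n) (p : Fin N × Fin n) :
    S.directFactor q i a p = ∑ j, (S.L ^ S.γ) i j * (S.Y j p.2 a * q j p.1) := by
  rw [directFactor, fuse_apply, Matrix.sum_apply]
  refine Finset.sum_congr rfl fun j _ => ?_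
  rw [Matrix.smul_apply, smul_eq_mul]
  refine congrArg ((S.L ^ S.γ) i j * ·) ((Matrix.mul_apply ..).trans ?_)
  rw [Finset.sum_eq_single p.2]
  · simp [rowKron]
  · intro b _ hb
    simp [rowKron, Matrix.one_apply_ne hb]
  · simp

variable {S} {G : SimpleGraph (Fin N)}

namespace StandingAssumptions

theorem weight_nonneg (hS : S.StandingAssumptions G) (i j : Fin N) : 0 ≤ (S.L ^ S.γ) i j :=
  nonneg_of_mem_doublyStochastic (pow_mem hS.doublyStochastic _)

theorem info_posSemidef (hS : S.StandingAssumptions G) (i : Fin N) : (S.info i).PosSemidef := by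
  rw [hS.factor]; exact Matrix.posSemidef_transpose_mul_self _

theorem fusedC_posSemidef (hS : S.StandingAssumptions G) (i : Fin N) :
    (S.fusedC i).PosSemidef :=
  Matrix.posSemidef_sum _ fun j _ => (hS.info_posSemidef j).smul (hS.weight_nonneg i j)

theorem fusedR_posSemidef (hS : S.StandingAssumptions G) (i : Fin N) :
    (S.fusedR i).PosSemidef :=
  Matrix.posSemidef_sum _ fun j _ => (hS.info_posSemidef j).smul (sq_nonneg _)

/-- The kernel of the fused noise covariance is the common kernel of the factors of the nodes that
contribute. -/
theorem weight_smul_mulVec_eq_zero (hS : S.StandingAssumptions G) {i : Fin N} {x : Fin n → ℝ}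
    (hx : S.fusedR i *ᵥ x = 0) (j : Fin N) : (S.L ^ S.γ) i j • (S.Y j *ᵥ x) = 0 := by
  have h0 : ∑ j, ((S.L ^ S.γ) i j • (S.Y j *ᵥ x)) ⬝ᵥ ((S.L ^ S.γ) i j • (S.Y j *ᵥ x)) = 0 := by
    have := congrArg (x ⬝ᵥ ·) hx
    simp only [fusedR, Matrix.sum_mulVec, dotProduct_sum, dotProduct_zero, Matrix.smul_mulVec,
      dotProduct_smul] at this
    rw [← this]
    refine Finset.sum_congr rfl fun j _ => ?_
    rw [hS.factor, ← Matrix.mulVec_mulVec x (S.Y j)ᵀ, Matrix.mulVec_transpose, dotProduct_comm x,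
      ← Matrix.dotProduct_mulVec, smul_dotProduct, dotProduct_smul, smul_smul, sq]
  rw [Finset.sum_eq_zero_iff_of_nonneg (fun j _ => by
    simpa using dotProduct_star_self_nonneg ((S.L ^ S.γ) i j • (S.Y j *ᵥ x)))] at h0
  exact dotProduct_self_eq_zero.mp (h0 j (Finset.mem_univ j))

/-- `C̃ x` is the sum of `(Y j)ᵀ` applied to the vectors `l i j • Y j x`, which all vanish on the
kernel of `R̃`. -/
theorem fusedC_mulVec_eq_zero (hS : S.StandingAssumptions G) {i : Fin N} {x : Fin n → ℝ}
    (hx : S.fusedR i *ᵥ x = 0) : S.fusedC i *ᵥ x = 0 := by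
  rw [fusedC, Matrix.sum_mulVec]
  refine Finset.sum_eq_zero fun j _ => ?_
  rw [hS.factor, Matrix.smul_mulVec, ← Matrix.mulVec_mulVec, ← Matrix.mulVec_smul,
    hS.weight_smul_mulVec_eq_zero hx, Matrix.mulVec_zero]

/-- The limiting information matrix of a node has the kernel of its fused observation matrix. -/
theorem fusedC_mulVec_eq_zero_of_information (hS : S.StandingAssumptions G) {i : Fin N}
    {x : Fin n → ℝ} (hx : ((S.fusedC i)ᵀ * pinv (S.fusedR i) * S.fusedC i) *ᵥ x = 0) :
    S.fusedC i *ᵥ x = 0 := by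
  have hR := hS.fusedR_posSemidef i
  have hC := (hS.fusedC_posSemidef i).transpose_eq
  have h1 : (S.fusedC i *ᵥ x) ⬝ᵥ pinv (S.fusedR i) *ᵥ (S.fusedC i *ᵥ x) = 0 := by
    have := dotProduct_mulVec_mul_mul (S.fusedC i)ᵀ (pinv (S.fusedR i)) (S.fusedC i)ᵀ x x
    rw [transpose_transpose, hx, dotProduct_zero] at this
    exact this.symm
  rw [(posSemidef_pinv hR).dotProduct_eq_zero_iff] at h1
  have h2 := hS.fusedC_mulVec_eq_zero (mulVec_eq_zero_of_pinv_mulVec hR.transpose_eq h1)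
  refine dotProduct_self_eq_zero.mp ?_
  rw [Matrix.dotProduct_mulVec, ← Matrix.mulVec_transpose, hC, h2, zero_dotProduct]

/-- The initial factor `N` cancels the `1 / N` of the consensus average. -/
theorem tendsto_directWeight (hS : S.StandingAssumptions G) (q : Fin N → Fin N → ℝ)
    (i : Fin N) : Tendsto (fun k => S.directWeight q k i) atTop
      (𝓝 ((Matrix.of q)ᵀ * Matrix.of q)) := by
  have hN : (N : ℝ) ≠ 0 := Nat.cast_ne_zero.mpr i.pos.ne'
  have hcons := tendsto_pow_doublyStochastic hS.doublyStochastic hS.self_weight_pos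
    (fun i j h => (hS.weight_pos_iff i j h.ne).mpr h) hS.connected
  rw [Matrix.tendsto_iff_entries]
  intro a b
  have h1 : ((Matrix.of q)ᵀ * Matrix.of q) a b =
      ∑ j, (N : ℝ)⁻¹ * ((N : ℝ) * (q j a * q j b)) := by
    simp [Matrix.mul_apply, inv_mul_cancel_left₀ hN]
  rw [h1]
  simp only [directWeight_eq, Matrix.sum_apply, Matrix.smul_apply, smul_eq_mul,
    Matrix.vecMulVec_apply, ← pow_mul]
  refine tendsto_finsetSum _ fun j _ => Tendsto.mul_const _ ?_
  exact (hcons i j).comp (tendsto_id.const_mul_atTop' hS.one_le_steps)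

theorem directWeight_posSemidef (hS : S.StandingAssumptions G) (q : Fin N → Fin N → ℝ) (k : ℕ)
    (i : Fin N) : (S.directWeight q k i).PosSemidef := by
  rw [directWeight_eq]
  refine Matrix.posSemidef_sum _ fun j _ => ?_
  refine Matrix.PosSemidef.smul (Matrix.PosSemidef.smul ?_ (Nat.cast_nonneg N))
    (nonneg_of_mem_doublyStochastic (pow_mem (pow_mem hS.doublyStochastic _) _))
  simpa using Matrix.posSemidef_vecMulVec_self_star (q j)

theorem directEstimate_posSemidef (hS : S.StandingAssumptions G) (q : Fin N → Fin N → ℝ) (k : ℕ)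
    (i : Fin N) : (S.directEstimate q k i).PosSemidef :=
  (posSemidef_pinv ((hS.directWeight_posSemidef q k i).kronecker
    Matrix.PosSemidef.one)).mul_mul_transpose _

/-- Already `ũ iᵀ` kills the kernel of `R̃`, whatever the weights are. So the kernel condition of
`tendsto_pinv` holds at every time. -/
theorem directEstimate_mulVec_eq_zero (hS : S.StandingAssumptions G) (q : Fin N → Fin N → ℝ)
    (k : ℕ) {i : Fin N} {x : Fin n → ℝ} (hx : S.fusedR i *ᵥ x = 0) :
    S.directEstimate q k i *ᵥ x = 0 := by
  have h : (S.directFactor q i)ᵀ *ᵥ x = 0 := by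
    ext p
    simp only [Matrix.mulVec, dotProduct, Matrix.transpose_apply, directFactor_apply,
      Finset.sum_mul, Pi.zero_apply]
    rw [Finset.sum_comm]
    refine Finset.sum_eq_zero fun j _ => ?_
    have h1 := congrFun (hS.weight_smul_mulVec_eq_zero hx j) p.2
    simp only [Pi.smul_apply, Matrix.mulVec, dotProduct, smul_eq_mul, Pi.zero_apply] at h1
    calc _ = (S.L ^ S.γ) i j * (∑ a, S.Y j p.2 a * x a) * q j p.1 := by
          rw [Finset.mul_sum, Finset.sum_mul]
          exact Finset.sum_congr rfl fun a _ => by ring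
      _ = 0 := by rw [h1, zero_mul]
  rw [directEstimate, ← Matrix.mulVec_mulVec, h, Matrix.mulVec_zero]

theorem fusedR_apply (hS : S.StandingAssumptions G) (i : Fin N) (a b : Fin n) :
    S.fusedR i a b = ∑ j, ∑ c, ((S.L ^ S.γ) i j) ^ 2 * (S.Y j c a * S.Y j c b) := by
  simp only [fusedR, Matrix.sum_apply, Matrix.smul_apply, hS.factor, Matrix.mul_apply,
    Matrix.transpose_apply, smul_eq_mul, Finset.mul_sum]

/-- The direct estimate converges to the fused noise covariance. -/
theorem tendsto_directEstimate (hS : S.StandingAssumptions G) {q : Fin N → Fin N → ℝ}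
    (hq : (Matrix.of q).det ≠ 0) (i : Fin N) :
    Tendsto (fun k => S.directEstimate q k i) atTop (𝓝 (S.fusedR i)) := by
  set K : Matrix (Fin N × Fin n) (Fin N × Fin n) ℝ := Matrix.of q ⊗ₖ 1 with hK
  have hKdet : IsUnit K.det := by
    rw [hK, Matrix.det_kronecker]
    simpa using IsUnit.pow n (isUnit_iff_ne_zero.mpr hq)
  have hKT : ((Matrix.of q)ᵀ * Matrix.of q) ⊗ₖ (1 : Matrix (Fin n) (Fin n) ℝ) = Kᵀ * K := by
    rw [hK, ← Matrix.kroneckerMap_transpose, ← Matrix.mul_kronecker_mul, Matrix.transpose_one,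
      Matrix.one_mul]
  have hu : IsUnit (Kᵀ * K).det := by
    rw [Matrix.det_mul, Matrix.det_transpose]; exact hKdet.mul hKdet
  have hlim : Tendsto (fun k => S.directWeight q k i ⊗ₖ (1 : Matrix (Fin n) (Fin n) ℝ)) atTop
      (𝓝 (Kᵀ * K)) := by
    have h1 := Matrix.tendsto_iff_entries.mp (hS.tendsto_directWeight q i)
    rw [← hKT, Matrix.tendsto_iff_entries]
    intro a b
    simp only [Matrix.kroneckerMap_apply]
    exact (h1 _ _).mul_const _
  have hlim2 := tendsto_pinv_of_isUnit hu hlim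
  -- The blocks of `E` are `l i j (Y j)ᵀ`, so `E Eᵀ = R̃` and `ũ = E K`; the invertible `K` cancels
  -- in `E K (Kᵀ K)⁻¹ Kᵀ Eᵀ`.
  set E : Matrix (Fin n) (Fin N × Fin n) ℝ :=
    Matrix.of fun a p => (S.L ^ S.γ) i p.1 * S.Y p.1 p.2 a with hE
  have hfac : S.directFactor q i = E * K := by
    ext a p
    rw [directFactor_apply, Matrix.mul_apply, Fintype.sum_prod_type]
    refine Finset.sum_congr rfl fun j _ => ?_
    rw [Finset.sum_eq_single p.2]
    · simp [hE, hK, mul_assoc]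
    · intro b _ hb
      simp [hK, Matrix.one_apply_ne hb]
    · simp
  have hval : S.fusedR i = S.directFactor q i * (Kᵀ * K)⁻¹ * (S.directFactor q i)ᵀ := by
    have h2 : S.directFactor q i * (Kᵀ * K)⁻¹ * (S.directFactor q i)ᵀ = E * Eᵀ := by
      have hKTdet : IsUnit Kᵀ.det := by rwa [Matrix.det_transpose]
      rw [hfac, Matrix.mul_inv_rev, transpose_mul]
      calc E * K * (K⁻¹ * Kᵀ⁻¹) * (Kᵀ * Eᵀ) = E * (K * K⁻¹) * (Kᵀ⁻¹ * Kᵀ) * Eᵀ := by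
            simp only [Matrix.mul_assoc]
        _ = E * Eᵀ := by
            rw [Matrix.mul_nonsing_inv _ hKdet, Matrix.nonsing_inv_mul _ hKTdet, Matrix.mul_one,
              Matrix.mul_one]
    rw [h2]
    ext a b
    rw [hS.fusedR_apply, Matrix.mul_apply, Fintype.sum_prod_type]
    refine Finset.sum_congr rfl fun j _ => Finset.sum_congr rfl fun c _ => ?_
    simp only [hE, Matrix.of_apply, Matrix.transpose_apply]
    ring
  rw [hval]
  exact Matrix.tendsto_mul (Matrix.tendsto_mul tendsto_const_nhds hlim2) tendsto_const_nhds

end StandingAssumptions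

end SensorNetwork

/-! ### Second moments of square integrable and of normal vectors -/

section SecondMoment

variable {Ω : Type*} [MeasurableSpace Ω] {μ : Measure Ω}
variable {ι κ τ : Type*} [Fintype ι] [Fintype κ] [Fintype τ]

theorem memLp_apply {X : Ω → ι → ℝ} (hX : MemLp X 2 μ) (a : ι) :
    MemLp (fun ω => X ω a) 2 μ := memLp_pi_iff.mp hX a

theorem memLp_add {X Y : Ω → ι → ℝ} (hX : MemLp X 2 μ) (hY : MemLp Y 2 μ) :
    MemLp (fun ω => X ω + Y ω) 2 μ := hX.add hY

theorem memLp_sub {X Y : Ω → ι → ℝ} (hX : MemLp X 2 μ) (hY : MemLp Y 2 μ) :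
    MemLp (fun ω => X ω - Y ω) 2 μ := hX.sub hY

theorem memLp_mulVec (M : Matrix κ ι ℝ) {X : Ω → ι → ℝ} (hX : MemLp X 2 μ) :
    MemLp (fun ω => M *ᵥ X ω) 2 μ :=
  memLp_pi_iff.mpr fun a => memLp_finsetSum _ fun b _ => (memLp_apply hX b).const_mul (M a b)

theorem secondMoment_add_left {X X' : Ω → ι → ℝ} {Y : Ω → κ → ℝ} (hX : MemLp X 2 μ)
    (hX' : MemLp X' 2 μ) (hY : MemLp Y 2 μ) :
    secondMoment μ (fun ω => X ω + X' ω) Y = secondMoment μ X Y + secondMoment μ X' Y := by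
  ext a b
  simp only [secondMoment, Matrix.of_apply, Matrix.add_apply, Pi.add_apply, add_mul]
  exact integral_add ((memLp_apply hX a).integrable_mul (memLp_apply hY b))
    ((memLp_apply hX' a).integrable_mul (memLp_apply hY b))

omit [Fintype τ] in
theorem secondMoment_mulVec_left (M : Matrix τ ι ℝ) {X : Ω → ι → ℝ} {Y : Ω → κ → ℝ}
    (hX : MemLp X 2 μ) (hY : MemLp Y 2 μ) :
    secondMoment μ (fun ω => M *ᵥ X ω) Y = M * secondMoment μ X Y := by
  ext a b
  simp only [secondMoment, Matrix.of_apply, Matrix.mul_apply, Matrix.mulVec, dotProduct,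
    Finset.sum_mul, mul_assoc]
  refine (integral_finsetSum _ fun c _ => Integrable.const_mul (f := fun ω => X ω c * Y ω b)
    ((memLp_apply hX c).integrable_mul (memLp_apply hY b)) (M a c)).trans ?_
  simp only [integral_const_mul]

theorem secondMoment_sum_left {σ : Type*} (s : Finset σ) {X : σ → Ω → ι → ℝ} {Y : Ω → κ → ℝ}
    (hX : ∀ j, MemLp (X j) 2 μ) (hY : MemLp Y 2 μ) :
    secondMoment μ (fun ω => ∑ j ∈ s, X j ω) Y = ∑ j ∈ s, secondMoment μ (X j) Y := by
  ext a b
  simp only [secondMoment, Matrix.of_apply, Matrix.sum_apply, Finset.sum_apply, Finset.sum_mul]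
  exact integral_finsetSum _ fun j _ => (memLp_apply (hX j) a).integrable_mul (memLp_apply hY b)

omit [Fintype ι] [Fintype κ] in
theorem secondMoment_transpose (X : Ω → ι → ℝ) (Y : Ω → κ → ℝ) :
    (secondMoment μ X Y)ᵀ = secondMoment μ Y X := by
  ext a b
  simp only [secondMoment, Matrix.of_apply, Matrix.transpose_apply, mul_comm]

omit [Fintype ι] [Fintype κ] in
theorem secondMoment_eq_zero_comm {X : Ω → ι → ℝ} {Y : Ω → κ → ℝ}
    (h : secondMoment μ X Y = 0) : secondMoment μ Y X = 0 := by
  rw [← secondMoment_transpose, h, Matrix.transpose_zero]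

omit [Fintype τ] in
theorem secondMoment_mulVec_right (M : Matrix τ κ ℝ) {X : Ω → ι → ℝ} {Y : Ω → κ → ℝ}
    (hX : MemLp X 2 μ) (hY : MemLp Y 2 μ) :
    secondMoment μ X (fun ω => M *ᵥ Y ω) = secondMoment μ X Y * Mᵀ := by
  rw [← secondMoment_transpose, secondMoment_mulVec_left M hY hX, Matrix.transpose_mul,
    secondMoment_transpose]

theorem secondMoment_add_right {X : Ω → ι → ℝ} {Y Y' : Ω → κ → ℝ} (hX : MemLp X 2 μ)
    (hY : MemLp Y 2 μ) (hY' : MemLp Y' 2 μ) :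
    secondMoment μ X (fun ω => Y ω + Y' ω) = secondMoment μ X Y + secondMoment μ X Y' := by
  rw [← secondMoment_transpose, secondMoment_add_left hY hY' hX, Matrix.transpose_add,
    secondMoment_transpose, secondMoment_transpose]

theorem secondMoment_add_self {X Y : Ω → ι → ℝ} (hX : MemLp X 2 μ) (hY : MemLp Y 2 μ)
    (h : secondMoment μ X Y = 0) :
    secondMoment μ (fun ω => X ω + Y ω) (fun ω => X ω + Y ω) =
      secondMoment μ X X + secondMoment μ Y Y := by
  have hXY : MemLp (fun ω => X ω + Y ω) 2 μ := hX.add hY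
  rw [secondMoment_add_left hX hY hXY, secondMoment_add_right hX hX hY,
    secondMoment_add_right hY hX hY, h, secondMoment_eq_zero_comm h, add_zero, zero_add]

theorem secondMoment_mulVec_self (M : Matrix κ ι ℝ) {X : Ω → ι → ℝ} (hX : MemLp X 2 μ) :
    secondMoment μ (fun ω => M *ᵥ X ω) (fun ω => M *ᵥ X ω) = M * secondMoment μ X X * Mᵀ := by
  rw [secondMoment_mulVec_left M hX (memLp_mulVec M hX), secondMoment_mulVec_right M hX hX,
    Matrix.mul_assoc]

end SecondMoment

namespace IsNormalVector

variable {Ω : Type*} [MeasurableSpace Ω] {μ : Measure Ω} {d : ℕ} {X : Ω → Fin d → ℝ}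
  {mean : Fin d → ℝ} {S : Matrix (Fin d) (Fin d) ℝ}

theorem memLp (h : IsNormalVector X mean S μ) : MemLp X 2 μ := by
  have h1 : MemLp id 2 (μ.map fun ω => WithLp.toLp 2 (X ω)) := by
    rw [HasLaw.map_eq h]; exact IsGaussian.memLp_two_id
  rw [memLp_map_measure_iff aestronglyMeasurable_id (HasLaw.aemeasurable h)] at h1
  refine memLp_pi_iff.mpr fun a => ?_
  exact (EuclideanSpace.proj (𝕜 := ℝ) a).comp_memLp' h1

theorem aemeasurable (h : IsNormalVector X mean S μ) : AEMeasurable X μ :=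
  (WithLp.measurable_ofLp 2 _).comp_aemeasurable (HasLaw.aemeasurable h)

theorem integral_apply (h : IsNormalVector X mean S μ) (a : Fin d) : ∫ ω, X ω a ∂μ = mean a := by
  have h1 : ∫ ω, (WithLp.toLp 2 (X ω) : EuclideanSpace ℝ (Fin d)) ∂μ = WithLp.toLp 2 mean := by
    have := HasLaw.integral_comp (f := id) h aestronglyMeasurable_id
    simpa [Function.comp_def] using this
  have h2 : Integrable (fun ω => (WithLp.toLp 2 (X ω) : EuclideanSpace ℝ (Fin d))) μ := by
    have h3 : MemLp id 2 (μ.map fun ω => WithLp.toLp 2 (X ω)) := by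
      rw [HasLaw.map_eq h]; exact IsGaussian.memLp_two_id
    rw [memLp_map_measure_iff aestronglyMeasurable_id (HasLaw.aemeasurable h)] at h3
    have : IsFiniteMeasure μ := by
      have := HasLaw.isProbabilityMeasure_iff h
      have := this.mpr inferInstance
      infer_instance
    exact h3.integrable one_le_two
  have h4 := (EuclideanSpace.proj (𝕜 := ℝ) a).integral_comp_comm h2
  rw [h1] at h4
  exact h4

theorem secondMoment_eq (h : IsNormalVector X 0 S μ) (hS : S.PosSemidef) :
    secondMoment μ X X = S := by
  ext a b
  have hc := covariance_eval_multivariateGaussian (μ := WithLp.toLp 2 (0 : Fin d → ℝ)) hS a b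
  have hm : IsProbabilityMeasure μ := (HasLaw.isProbabilityMeasure_iff h).mpr inferInstance
  rw [← HasLaw.map_eq h, covariance_map (by fun_prop) (by fun_prop) (HasLaw.aemeasurable h)] at hc
  have hX := h.memLp
  have h2 := covariance_eq_sub (memLp_apply hX a) (memLp_apply hX b)
  simp only [Function.comp_def] at hc
  rw [h2] at hc
  simpa [h.integral_apply, secondMoment] using hc

end IsNormalVector

/-! ### Dynamics and covariance of the true prior error -/

namespace SensorNetwork

variable {N n : ℕ} {S : SensorNetwork N n} {G : SimpleGraph (Fin N)}
  {Ω : Type*} {x0 : Ω → Fin n → ℝ} {w : ℕ → Ω → Fin n → ℝ} {v : (i : Fin N) → ℕ → Ω → Fin (S.m i) → ℝ}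

variable (S) in
/-- The noise of the fused measurement of node `i` at time `k`. -/
def fusedNoise (v : (i : Fin N) → ℕ → Ω → Fin (S.m i) → ℝ) (i : Fin N) (k : ℕ) (ω : Ω) :
    Fin n → ℝ :=
  ∑ j, ((S.L ^ S.γ) i j • ((S.C j)ᵀ * (S.R j)⁻¹)) *ᵥ v j k ω

theorem fusedMeasurement_eq (k : ℕ) (ω : Ω) (i : Fin N) :
    S.fusedMeasurement x0 w v k ω i =
      S.fusedC i *ᵥ S.state x0 w k ω + S.fusedNoise v i k ω := by
  rw [fusedMeasurement, fuse_apply, fusedC, fusedNoise, Matrix.sum_mulVec,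
    ← Finset.sum_add_distrib]
  refine Finset.sum_congr rfl fun j _ => ?_
  rw [measurement, Matrix.mulVec_add, smul_add, Matrix.mulVec_mulVec, Matrix.smul_mulVec,
    Matrix.smul_mulVec, info]

variable (S) in
/-- The information matrix that node `i` uses at time `k`. -/
def informationMatrix (U : ℕ → Fin N → Matrix (Fin n) (Fin n) ℝ) (i : Fin N) (k : ℕ) :
    Matrix (Fin n) (Fin n) ℝ := (S.fusedC i)ᵀ * pinv (U k i) * S.fusedC i

theorem informationMatrix_posSemidef {U : ℕ → Fin N → Matrix (Fin n) (Fin n) ℝ} {i : Fin N}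
    {k : ℕ} (hU : (U k i).PosSemidef) : (S.informationMatrix U i k).PosSemidef :=
  (posSemidef_pinv hU).transpose_mul_mul _

theorem priorCov_succ (U : ℕ → Fin N → Matrix (Fin n) (Fin n) ℝ) (i : Fin N) (k : ℕ) :
    S.priorCov U i (k + 1) =
      riccatiStep S.A S.Q (S.priorCov U i k) (S.informationMatrix U i (k + 1)) := rfl

theorem priorCov_posDef (hS : S.StandingAssumptions G)
    {U : ℕ → Fin N → Matrix (Fin n) (Fin n) ℝ} {i : Fin N} (hU : ∀ k, (U k i).PosSemidef)
    (k : ℕ) : (S.priorCov U i k).PosDef := by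
  induction k with
  | zero => exact hS.Q_pos.posSemidef_add (hS.P0_pos.posSemidef.mul_mul_transpose S.A)
  | succ k ih =>
    rw [priorCov_succ]
    exact riccatiStep_posDef hS.Q_pos ih (informationMatrix_posSemidef (hU _))

/-- Split `A x` by `Φ (P⁻¹ + G) = 1`: the part `A Φ G x` cancels the signal in the fused
measurement, and the part `A Φ P⁻¹ x` combines with the prior estimate into the old error. -/
theorem priorError_succ (hS : S.StandingAssumptions G)
    {U : ℕ → Fin N → Matrix (Fin n) (Fin n) ℝ} {i : Fin N} (hU : ∀ k, (U k i).PosSemidef)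
    (k : ℕ) (ω : Ω) :
    S.priorError x0 w v U i (k + 1) ω =
      (errorGain S.A (S.priorCov U i k) (S.informationMatrix U i (k + 1)) *ᵥ
          S.priorError x0 w v U i k ω +
        (-(S.A * infoUpdate (S.priorCov U i k) (S.informationMatrix U i (k + 1)) *
          (S.fusedC i)ᵀ * pinv (U (k + 1) i))) *ᵥ S.fusedNoise v i (k + 1) ω) + w (k + 1) ω := by
  have hP := priorCov_posDef hS hU k
  have hG := informationMatrix_posSemidef (S := S) (hU (k + 1))
  have hΦ := infoUpdate_mul hP hG
  have hdef : S.priorError x0 w v U i (k + 1) ω =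
      S.A *ᵥ S.state x0 w (k + 1) ω + w (k + 1) ω - S.A *ᵥ (S.postCov U i (k + 1) *ᵥ
        ((S.priorCov U i k)⁻¹ *ᵥ (S.A *ᵥ S.postEst x0 w v U i k ω) +
          ((S.fusedC i)ᵀ * pinv (U (k + 1) i)) *ᵥ S.fusedMeasurement x0 w v (k + 1) ω i)) := rfl
  rw [hdef, fusedMeasurement_eq, errorGain]
  set x := S.state x0 w (k + 1) ω with hx
  set ν := S.fusedNoise v i (k + 1) ω
  have hpost : S.postCov U i (k + 1) =
      infoUpdate (S.priorCov U i k) (S.informationMatrix U i (k + 1)) := rfl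
  have he : S.priorError x0 w v U i k ω = x - S.A *ᵥ S.postEst x0 w v U i k ω := rfl
  rw [hpost, he]
  set Φ := infoUpdate (S.priorCov U i k) (S.informationMatrix U i (k + 1)) with hΦdef
  set xh := S.A *ᵥ S.postEst x0 w v U i k ω
  have hx1 : S.A *ᵥ x = (S.A * Φ * (S.priorCov U i k)⁻¹) *ᵥ x +
      (S.A * Φ * (S.fusedC i)ᵀ * pinv (U (k + 1) i) * S.fusedC i) *ᵥ x := by
    rw [← Matrix.add_mulVec]
    congr 1
    have : S.A * Φ * (S.priorCov U i k)⁻¹ +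
        S.A * Φ * (S.fusedC i)ᵀ * pinv (U (k + 1) i) * S.fusedC i =
        S.A * (Φ * ((S.priorCov U i k)⁻¹ + S.informationMatrix U i (k + 1))) := by
      rw [informationMatrix]; noncomm_ring
    rw [this, hΦ, Matrix.mul_one]
  rw [hx1]
  simp only [Matrix.mulVec_add, Matrix.mulVec_sub, Matrix.mulVec_mulVec, Matrix.neg_mulVec,
    Matrix.mul_assoc]
  abel

variable [MeasurableSpace Ω] {μ : Measure Ω}

namespace NoiseModel

theorem memLp_fusedNoise (hn : S.NoiseModel μ x0 w v) (i : Fin N) (k : ℕ) :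
    MemLp (S.fusedNoise v i (k + 1)) 2 μ :=
  memLp_finsetSum _ fun j _ => memLp_mulVec _ (hn.law_v j (k + 1) (by omega)).memLp

theorem memLp_state (hn : S.NoiseModel μ x0 w v) (k : ℕ) : MemLp (S.state x0 w k) 2 μ := by
  induction k with
  | zero => exact hn.law_x0.memLp
  | succ k ih => exact memLp_add (memLp_mulVec S.A ih) (hn.law_w k).memLp

theorem secondMoment_fusedNoise_left (hn : S.NoiseModel μ x0 w v) {ι : Type*} [Fintype ι]
    {X : Ω → ι → ℝ} (hX : MemLp X 2 μ) (i : Fin N) (k : ℕ) :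
    secondMoment μ (S.fusedNoise v i (k + 1)) X =
      ∑ j, ((S.L ^ S.γ) i j • ((S.C j)ᵀ * (S.R j)⁻¹)) * secondMoment μ (v j (k + 1)) X := by
  have hv : ∀ j, MemLp (v j (k + 1)) 2 μ := fun j => (hn.law_v j (k + 1) (by omega)).memLp
  refine (secondMoment_sum_left Finset.univ (fun j => memLp_mulVec _ (hv j)) hX).trans ?_
  exact Finset.sum_congr rfl fun j _ => secondMoment_mulVec_left _ (hv j) hX

/-- Noises of different nodes are uncorrelated, so only squared weights survive, each with `Cᵀ R⁻¹ R
R⁻¹ C = Cᵀ R⁻¹ C`. -/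
theorem secondMoment_fusedNoise (hS : S.StandingAssumptions G) (hn : S.NoiseModel μ x0 w v)
    (i : Fin N) (k : ℕ) :
    secondMoment μ (S.fusedNoise v i (k + 1)) (S.fusedNoise v i (k + 1)) = S.fusedR i := by
  rw [hn.secondMoment_fusedNoise_left (hn.memLp_fusedNoise i k), fusedR]
  refine Finset.sum_congr rfl fun j _ => ?_
  have hv := hn.law_v j (k + 1) (by omega)
  rw [← secondMoment_transpose (S.fusedNoise v i (k + 1)),
    hn.secondMoment_fusedNoise_left hv.memLp, Finset.sum_eq_single j]
  · have hR := hS.R_pos j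
    rw [hv.secondMoment_eq hR.posSemidef, Matrix.transpose_mul, Matrix.transpose_smul,
      Matrix.transpose_mul, hR.transpose_eq, hR.inv.transpose_eq, transpose_transpose, info,
      Matrix.smul_mul, Matrix.mul_smul, Matrix.mul_smul, smul_smul, sq]
    congr 1
    rw [← Matrix.mul_assoc (S.R j), Matrix.mul_nonsing_inv _ hR.isUnit_det, Matrix.one_mul]
  · intro j' _ hj'
    rw [hn.v_white j' j (k + 1) (k + 1) (by omega) (by omega) (Or.inl hj'), Matrix.mul_zero]
  · simp

theorem secondMoment_fusedNoise_w (hn : S.NoiseModel μ x0 w v) (i : Fin N) (k h : ℕ) :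
    secondMoment μ (S.fusedNoise v i (k + 1)) (w h) = 0 := by
  rw [hn.secondMoment_fusedNoise_left (hn.law_w h).memLp]
  refine Finset.sum_eq_zero fun j _ => ?_
  rw [secondMoment_eq_zero_comm (hn.w_v h j (k + 1) (by omega)), Matrix.mul_zero]

theorem secondMoment_fusedNoise_v (hn : S.NoiseModel μ x0 w v) (i j : Fin N) {k t : ℕ}
    (h : k + 1 < t) : secondMoment μ (S.fusedNoise v i (k + 1)) (v j t) = 0 := by
  rw [hn.secondMoment_fusedNoise_left (hn.law_v j t (by omega)).memLp]
  refine Finset.sum_eq_zero fun j' _ => ?_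
  rw [hn.v_white j' j (k + 1) t (by omega) (by omega) (Or.inr (by omega)), Matrix.mul_zero]

variable [IsProbabilityMeasure μ]

theorem memLp_postEst (hn : S.NoiseModel μ x0 w v)
    (U : ℕ → Fin N → Matrix (Fin n) (Fin n) ℝ) (i : Fin N) (k : ℕ) :
    MemLp (S.postEst x0 w v U i k) 2 μ := by
  induction k with
  | zero => exact memLp_const _
  | succ k ih =>
    refine memLp_mulVec _ (memLp_add (memLp_mulVec _ (memLp_mulVec S.A ih)) (memLp_mulVec _ ?_))
    simp only [fusedMeasurement_eq]
    exact memLp_add (memLp_mulVec _ (hn.memLp_state (k + 1))) (hn.memLp_fusedNoise i k)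

theorem memLp_priorError (hn : S.NoiseModel μ x0 w v)
    (U : ℕ → Fin N → Matrix (Fin n) (Fin n) ℝ) (i : Fin N) (k : ℕ) :
    MemLp (S.priorError x0 w v U i k) 2 μ :=
  memLp_sub (hn.memLp_state (k + 1)) (memLp_mulVec S.A (hn.memLp_postEst U i k))

/-- The prior error is uncorrelated with every variable that is uncorrelated with the initial
state and with the past disturbances and noises. -/
theorem secondMoment_priorError_eq_zero (hS : S.StandingAssumptions G)
    (hn : S.NoiseModel μ x0 w v) {U : ℕ → Fin N → Matrix (Fin n) (Fin n) ℝ} {i : Fin N}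
    (hU : ∀ k, (U k i).PosSemidef) {ι : Type*} [Fintype ι] {X : Ω → ι → ℝ} (hX : MemLp X 2 μ)
    {k : ℕ} (h0 : secondMoment μ (fun ω => x0 ω - S.xhat0) X = 0)
    (hw : ∀ h ≤ k, secondMoment μ (w h) X = 0)
    (hv : ∀ h < k, secondMoment μ (S.fusedNoise v i (h + 1)) X = 0) :
    secondMoment μ (S.priorError x0 w v U i k) X = 0 := by
  induction k with
  | zero =>
    have hx : MemLp (fun ω => x0 ω - S.xhat0) 2 μ := memLp_sub hn.law_x0.memLp (memLp_const _)
    have : S.priorError x0 w v U i 0 = fun ω => S.A *ᵥ (x0 ω - S.xhat0) + w 0 ω := by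
      funext ω
      simp only [priorError, state, postEst, Matrix.mulVec_sub]
      abel
    rw [this, secondMoment_add_left (memLp_mulVec _ hx) (hn.law_w 0).memLp hX,
      secondMoment_mulVec_left _ hx hX, h0, hw 0 le_rfl, Matrix.mul_zero, add_zero]
  | succ k ih =>
    have hE := hn.memLp_priorError U i k
    have hν := hn.memLp_fusedNoise i k
    rw [funext (priorError_succ (x0 := x0) (w := w) (v := v) hS hU k),
      secondMoment_add_left (memLp_add (memLp_mulVec _ hE) (memLp_mulVec _ hν)) (hn.law_w _).memLp hX,
      secondMoment_add_left (memLp_mulVec _ hE) (memLp_mulVec _ hν) hX,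
      secondMoment_mulVec_left _ hE hX, secondMoment_mulVec_left _ hν hX,
      ih (fun h hh => hw h (by omega)) (fun h hh => hv h (by omega)), hv k (by omega),
      hw _ le_rfl]
    simp

/-- The recursion of the true prior error covariance. -/
theorem truePriorCov_succ (hS : S.StandingAssumptions G)
    (hn : S.NoiseModel μ x0 w v) {U : ℕ → Fin N → Matrix (Fin n) (Fin n) ℝ} {i : Fin N}
    (hU : ∀ k, (U k i).PosSemidef) (k : ℕ) :
    S.truePriorCov x0 w v μ U i (k + 1) =
      errorGain S.A (S.priorCov U i k) (S.informationMatrix U i (k + 1)) *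
          S.truePriorCov x0 w v μ U i k *
          (errorGain S.A (S.priorCov U i k) (S.informationMatrix U i (k + 1)))ᵀ +
        S.A * infoUpdate (S.priorCov U i k) (S.informationMatrix U i (k + 1)) *
          ((S.fusedC i)ᵀ * pinv (U (k + 1) i) * S.fusedR i * pinv (U (k + 1) i) * S.fusedC i) *
          (infoUpdate (S.priorCov U i k) (S.informationMatrix U i (k + 1)) * S.Aᵀ) + S.Q := by
  have hE := hn.memLp_priorError U i k
  have hν := hn.memLp_fusedNoise i k
  have hw := hn.law_w (k + 1)
  -- The prior error at `k` involves fused noise only up to time `k`, so the noise at `k + 1` is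
  -- new.
  have hEν : secondMoment μ (S.priorError x0 w v U i k) (S.fusedNoise v i (k + 1)) = 0 := by
    refine secondMoment_eq_zero_comm ?_
    rw [hn.secondMoment_fusedNoise_left hE]
    refine Finset.sum_eq_zero fun j _ => ?_
    rw [secondMoment_eq_zero_comm (hn.secondMoment_priorError_eq_zero hS hU
      (hn.law_v j (k + 1) (by omega)).memLp (hn.x0_v j (k + 1) (by omega))
      (fun h _ => hn.w_v h j (k + 1) (by omega))
      (fun h hh => hn.secondMoment_fusedNoise_v i j (by omega))), Matrix.mul_zero]
  have hEw : secondMoment μ (S.priorError x0 w v U i k) (w (k + 1)) = 0 :=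
    hn.secondMoment_priorError_eq_zero hS hU hw.memLp (hn.x0_w _)
      (fun h _ => hn.w_white h (k + 1) (by omega))
      (fun h _ => hn.secondMoment_fusedNoise_w i h (k + 1))
  have hνw := hn.secondMoment_fusedNoise_w i k (k + 1)
  have hΦ := infoUpdate_posDef (priorCov_posDef hS hU k)
    (informationMatrix_posSemidef (S := S) (hU (k + 1)))
  rw [truePriorCov, truePriorCov,
    funext (priorError_succ (x0 := x0) (w := w) (v := v) hS hU k),
    secondMoment_add_self (memLp_add (memLp_mulVec _ hE) (memLp_mulVec _ hν)) hw.memLp,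
    secondMoment_add_self (memLp_mulVec _ hE) (memLp_mulVec _ hν),
    secondMoment_mulVec_self _ hE, secondMoment_mulVec_self _ hν, hn.secondMoment_fusedNoise hS,
    hw.secondMoment_eq hS.Q_pos.posSemidef]
  · congr 2
    rw [Matrix.transpose_neg, Matrix.neg_mul, Matrix.neg_mul, Matrix.mul_neg, neg_neg]
    simp only [Matrix.transpose_mul, transpose_transpose, hΦ.transpose_eq,
      pinv_transpose_of_symm (hU (k + 1)).transpose_eq, Matrix.mul_assoc]
  · rw [secondMoment_mulVec_left _ hE (memLp_mulVec _ hν), secondMoment_mulVec_right _ hE hν, hEν]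
    simp
  · rw [secondMoment_add_left (memLp_mulVec _ hE) (memLp_mulVec _ hν) hw.memLp,
      secondMoment_mulVec_left _ hE hw.memLp, secondMoment_mulVec_left _ hν hw.memLp, hEw, hνw]
    simp

end NoiseModel

/-- The kernel of `C̃ᵀ R̃† C̃` lies in that of `C̃`, so observability passes from `C̃` to the
limiting information matrix. -/
theorem StandingAssumptions.information_observable (hS : S.StandingAssumptions G) {i : Fin N}
    (hobs : Observable S.A (S.fusedC i)) (x : Fin n → ℝ)
    (hx : ∀ k < n, ((S.fusedC i)ᵀ * pinv (S.fusedR i) * S.fusedC i * S.A ^ k) *ᵥ x = 0) :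
    x = 0 := by
  refine hobs x fun k hk => ?_
  rw [← Matrix.mulVec_mulVec]
  refine hS.fusedC_mulVec_eq_zero_of_information ?_
  rw [Matrix.mulVec_mulVec]
  exact hx k hk

/-- If the estimates of the fused noise covariance are positive semidefinite, have at least its
kernel, and converge to it, then the true prior error covariance converges to the solution of the
Riccati equation. -/
theorem tendsto_truePriorCov [IsProbabilityMeasure μ] (hS : S.StandingAssumptions G) (hn : S.NoiseModel μ x0 w v)
    {i : Fin N} (hobs : Observable S.A (S.fusedC i)) {P : Matrix (Fin n) (Fin n) ℝ}
    (hP : ∀ P' G', RiccatiRun S.A S.Q ((S.fusedC i)ᵀ * pinv (S.fusedR i) * S.fusedC i) P' G' →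
      Tendsto P' atTop (𝓝 P))
    {U : ℕ → Fin N → Matrix (Fin n) (Fin n) ℝ} (hU : ∀ k, (U k i).PosSemidef)
    (hker : ∀ k x, S.fusedR i *ᵥ x = 0 → U k i *ᵥ x = 0)
    (hlim : Tendsto (fun k => U k i) atTop (𝓝 (S.fusedR i))) :
    Tendsto (S.truePriorCov x0 w v μ U i) atTop (𝓝 P) := by
  have hR := hS.fusedR_posSemidef i
  -- Shifted by one: the step from index `k` to `k + 1` of the prior covariance uses the estimate at
  -- time `k + 1`.
  have hpinv := (tendsto_pinv hR.transpose_eq (fun k => (hU k).transpose_eq) hker hlim).1.comp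
    (tendsto_add_atTop_nat 1)
  have hrun : RiccatiRun S.A S.Q ((S.fusedC i)ᵀ * pinv (S.fusedR i) * S.fusedC i)
      (S.priorCov U i) (fun k => S.informationMatrix U i (k + 1)) :=
    { Q_pos := hS.Q_pos
      init_pos := priorCov_posDef hS hU 0
      H_nonneg := (posSemidef_pinv hR).transpose_mul_mul _
      G_nonneg := fun k => informationMatrix_posSemidef (hU _)
      step := fun k => priorCov_succ U i k
      ker := fun k x hx => by
        rw [informationMatrix, ← Matrix.mulVec_mulVec,
          hS.fusedC_mulVec_eq_zero_of_information hx, Matrix.mulVec_zero]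
      lim := (hpinv.const_mul (S.fusedC i)ᵀ).mul_const (S.fusedC i) }
  have hM : Tendsto (fun k => (S.fusedC i)ᵀ * pinv (U (k + 1) i) * S.fusedR i *
      pinv (U (k + 1) i) * S.fusedC i) atTop
      (𝓝 ((S.fusedC i)ᵀ * pinv (S.fusedR i) * S.fusedC i)) := by
    have := (((hpinv.const_mul (S.fusedC i)ᵀ).mul_const (S.fusedR i)).mul hpinv).mul_const
      (S.fusedC i)
    have he : (S.fusedC i)ᵀ * pinv (S.fusedR i) * S.fusedR i * pinv (S.fusedR i) =
        (S.fusedC i)ᵀ * pinv (S.fusedR i) := by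
      conv_rhs => rw [← (pinv_spec (S.fusedR i)).mul_mul_inv]
      simp only [Matrix.mul_assoc]
    rwa [he] at this
  have h1 := hrun.tendsto_true_sub (hS.information_observable hobs) hM
    (hn.truePriorCov_succ hS hU)
  simpa using h1.add (hP _ _ hrun)

end SensorNetwork

/-! ### Almost sure invertibility of a Gaussian matrix -/

/-- The zero set of a nonzero polynomial is null for a product of atomless measures. -/
theorem MvPolynomial.ae_eval_ne_zero (ρ : Measure ℝ) [SigmaFinite ρ] [NullSingletonClass ρ]
    {m : ℕ} {p : MvPolynomial (Fin m) ℝ} (hp : p ≠ 0) :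
    ∀ᵐ x ∂(Measure.pi fun _ : Fin m => ρ), MvPolynomial.eval x p ≠ 0 := by
  induction m with
  | zero =>
    refine Filter.Eventually.of_forall fun x hx => hp ?_
    refine MvPolynomial.funext fun y => ?_
    rw [Subsingleton.elim y x, hx, map_zero]
  | succ m ih =>
    have hmp := measurePreserving_piFinSuccAbove (fun _ : Fin (m + 1) => ρ) 0
    have hf : MvPolynomial.finSuccEquiv ℝ m p ≠ 0 := by simpa using hp
    obtain ⟨d, hd⟩ : ∃ d, (MvPolynomial.finSuccEquiv ℝ m p).coeff d ≠ 0 := by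
      by_contra! h
      exact hf (Polynomial.ext fun d => by simpa using h d)
    have hmeas : MeasurableSet
        {z : ℝ × (Fin m → ℝ) | MvPolynomial.eval (Fin.cons z.1 z.2 : Fin (m + 1) → ℝ) p ≠ 0} := by
      have hc : Continuous fun z : ℝ × (Fin m → ℝ) =>
          MvPolynomial.eval (Fin.cons z.1 z.2 : Fin (m + 1) → ℝ) p := by
        refine (MvPolynomial.continuous_eval p).comp ?_
        exact Continuous.finCons continuous_fst continuous_snd
      exact (isOpen_compl_singleton.preimage hc).measurableSet
    have hprod : ∀ᵐ z ∂(ρ.prod (Measure.pi fun _ : Fin m => ρ)),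
        MvPolynomial.eval (Fin.cons z.1 z.2 : Fin (m + 1) → ℝ) p ≠ 0 := by
      -- Fix the tail first: for almost every `y` the coefficient of degree `d` is nonzero, so only
      -- finitely many first coordinates are roots.
      rw [Measure.ae_prod_iff_ae_ae hmeas, Measure.ae_ae_comm hmeas]
      refine (ih hd).mono fun y hy => ?_
      have hne : Polynomial.map (MvPolynomial.eval y) (MvPolynomial.finSuccEquiv ℝ m p) ≠ 0 :=
        fun h0 => hy (by rw [← MvPolynomial.coeff_eval_eq_eval_coeff, h0, Polynomial.coeff_zero])
      refine compl_mem_ae_iff.mpr ((Polynomial.map (MvPolynomial.eval y)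
        (MvPolynomial.finSuccEquiv ℝ m p)).roots.toFinset.finite_toSet.countable.measure_zero ρ |>
          measure_mono_null fun x hx => ?_)
      have hx' : MvPolynomial.eval (Fin.cons x y : Fin (m + 1) → ℝ) p = 0 := by
        exact hx
      rw [MvPolynomial.eval_eq_eval_mv_eval'] at hx'
      simpa [hne] using hx'
    refine (hmp.quasiMeasurePreserving.ae hprod).mono fun x hx => ?_
    have : (Fin.cons (MeasurableEquiv.piFinSuccAbove (fun _ : Fin (m + 1) => ℝ) 0 x).1
        (MeasurableEquiv.piFinSuccAbove (fun _ : Fin (m + 1) => ℝ) 0 x).2 : Fin (m + 1) → ℝ) = x :=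
      Fin.cons_self_tail x
    rwa [this] at hx

/-- A matrix with independent standard normal entries is almost surely invertible. -/
theorem ae_det_ne_zero {N : ℕ} {Ω : Type*} [MeasurableSpace Ω] {ν : Measure Ω}
    {q : Fin N → Fin N → Ω → ℝ}
    (hlaw : ∀ i j, HasLaw (q i j) (gaussianReal 0 1) ν)
    (hindep : iIndepFun (fun p : Fin N × Fin N => q p.1 p.2) ν) :
    ∀ᵐ ω ∂ν, (Matrix.of fun a b => q a b ω).det ≠ 0 := by
  have : NullSingletonClass (gaussianReal 0 1) := nullSingletonClass_gaussianReal one_ne_zero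
  set e : Fin (Fintype.card (Fin N × Fin N)) ≃ Fin N × Fin N := (Fintype.equivFin _).symm
  have hpi := (hindep.precomp e.injective).hasLaw_pi (fun k => hlaw (e k).1 (e k).2)
  set M : Matrix (Fin N) (Fin N) (MvPolynomial (Fin (Fintype.card (Fin N × Fin N))) ℝ) :=
    Matrix.of fun a b => MvPolynomial.X (e.symm (a, b)) with hM
  have heval : ∀ x, MvPolynomial.eval x M.det =
      (Matrix.of fun a b => x (e.symm (a, b))).det := by
    intro x
    rw [RingHom.map_det]
    congr 1
    ext a b
    simp [hM]
  -- The generic determinant takes the value one at the identity matrix.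
  have hp : M.det ≠ 0 := by
    intro h0
    have := heval fun k => (1 : Matrix (Fin N) (Fin N) ℝ) (e k).1 (e k).2
    have h1 : (Matrix.of fun a b => (1 : Matrix (Fin N) (Fin N) ℝ) (e (e.symm (a, b))).1
        (e (e.symm (a, b))).2) = 1 := by
      ext a b
      rw [Matrix.of_apply, Equiv.apply_symm_apply]
    rw [h0, map_zero, h1, Matrix.det_one] at this
    exact zero_ne_one this
  have hae := MvPolynomial.ae_eval_ne_zero (gaussianReal 0 1) hp
  rw [← hpi.map_eq] at hae
  refine (ae_of_ae_map hpi.aemeasurable hae).mono fun ω hω => ?_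
  rw [heval] at hω
  simpa using hω

/-! ### Almost sure convergence of the stochastic estimate -/

section StochasticEstimate

variable {N n : ℕ} {Ω : Type*} [MeasurableSpace Ω] {ν : Measure Ω} [IsProbabilityMeasure ν]
  {θ : Fin N → ℕ → Ω → Fin n → ℝ}

/-- The law of large numbers for the products of the coordinates of the samples. -/
theorem ae_tendsto_average_mul (hlaw : ∀ i k, 1 ≤ k → IsNormalVector (θ i k) 0 1 ν)
    (hindep : iIndepFun (fun p : Fin N × ℕ => θ p.1 (p.2 + 1)) ν) (i j : Fin N) (c d : Fin n) :
    ∀ᵐ ω ∂ν, Tendsto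
      (fun k : ℕ => (∑ t ∈ Finset.range k, θ i (t + 1) ω c * θ j (t + 1) ω d) / k) atTop
      (𝓝 (if i = j ∧ c = d then 1 else 0)) := by
  have hl : ∀ i t, IsNormalVector (θ i (t + 1)) 0 1 ν := fun i t => hlaw i (t + 1) (by omega)
  have hm : ∀ p : Fin N × ℕ, AEMeasurable (θ p.1 (p.2 + 1)) ν := fun p => (hl p.1 p.2).aemeasurable
  have hL : ∀ i t c, MemLp (fun ω => θ i (t + 1) ω c) 2 ν := fun i t c =>
    memLp_apply (hl i t).memLp c
  have hid : ∀ i t, IdentDistrib (θ i (t + 1)) (θ i (0 + 1)) ν ν := fun i t =>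
    (HasLaw.identDistrib (hl i t) (hl i 0)).comp (WithLp.measurable_ofLp 2 _)
  have hmul : Measurable fun z : (Fin n → ℝ) × (Fin n → ℝ) => z.1 c * z.2 d := by fun_prop
  have hpair : i ≠ j → ∀ t, IndepFun (θ i (t + 1)) (θ j (t + 1)) ν := fun hij t =>
    hindep.indepFun (i := (i, t)) (j := (j, t)) (by simpa using hij)
  have hslln := strong_law_ae_real (fun t ω => θ i (t + 1) ω c * θ j (t + 1) ω d)
    ((hL i 0 c).integrable_mul (hL j 0 d)) ?_ ?_
  · have hmean : ∫ ω, θ i (0 + 1) ω c * θ j (0 + 1) ω d ∂ν = if i = j ∧ c = d then 1 else 0 := by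
      by_cases hij : i = j
      · subst hij
        have := congrFun (congrFun ((hl i 0).secondMoment_eq Matrix.PosSemidef.one) c) d
        simpa [secondMoment, Matrix.one_apply] using this
      · have hic : IndepFun (fun ω => θ i (0 + 1) ω c) (fun ω => θ j (0 + 1) ω d) ν :=
          (hpair hij 0).comp (measurable_pi_apply c) (measurable_pi_apply d)
        rw [hic.integral_fun_mul_eq_mul_integral (hL i 0 c).aestronglyMeasurable
          (hL j 0 d).aestronglyMeasurable, (hl i 0).integral_apply]
        simp [hij]
    rw [← hmean]
    exact hslln
  · intro s t hst
    -- Products at different times depend on disjoint sets of samples, also when `i = j`.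
    exact (hindep.indepFun_prodMk_prodMk₀ hm (i, s) (j, s) (i, t) (j, t) (by simp [hst])
      (by simp [hst]) (by simp [hst]) (by simp [hst])).comp hmul hmul
  · intro t
    by_cases hij : i = j
    · subst hij
      exact (hid i t).comp (u := fun z : Fin n → ℝ => z c * z d) (by fun_prop)
    · exact ((hid i t).prodMk (hid j t) (hpair hij t) (hpair hij 0)).comp hmul

end StochasticEstimate

namespace SensorNetwork

variable {N n : ℕ} (S : SensorNetwork N n)

theorem fusedSample_apply (θ : Fin N → ℕ → Fin n → ℝ) (k : ℕ) (i : Fin N) (a : Fin n) :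
    S.fusedSample θ k i a =
      ∑ p : Fin N × Fin n, (S.L ^ S.γ) i p.1 * S.Y p.1 p.2 a * θ p.1 k p.2 := by
  rw [Fintype.sum_prod_type]
  simp only [fusedSample, fuse_apply, Finset.sum_apply, Pi.smul_apply, smul_eq_mul, Matrix.mulVec,
    dotProduct, Matrix.transpose_apply, Finset.mul_sum, mul_assoc]

/-- The recursion is that of a running mean; at `k = 0` the sum is empty. -/
theorem stochasticEstimate_eq (θ : Fin N → ℕ → Fin n → ℝ) (k : ℕ) (i : Fin N) :
    S.stochasticEstimate θ k i = (k : ℝ)⁻¹ • ∑ t ∈ Finset.range k,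
      Matrix.vecMulVec (S.fusedSample θ (t + 1) i) (S.fusedSample θ (t + 1) i) := by
  induction k with
  | zero => simp [stochasticEstimate]
  | succ k ih =>
    change ((k : ℝ) / (k + 1)) • S.stochasticEstimate θ k i + (1 / ((k : ℝ) + 1)) • _ = _
    rw [ih, Finset.sum_range_succ, smul_add, smul_smul]
    push_cast
    rcases Nat.eq_zero_or_pos k with rfl | hk
    · simp
    · rw [one_div]
      congr 2
      have : (k : ℝ) ≠ 0 := by positivity
      field_simp

variable {S} {G : SimpleGraph (Fin N)}

theorem stochasticEstimate_posSemidef (θ : Fin N → ℕ → Fin n → ℝ) (k : ℕ) (i : Fin N) :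
    (S.stochasticEstimate θ k i).PosSemidef := by
  rw [stochasticEstimate_eq]
  refine Matrix.PosSemidef.smul (Matrix.posSemidef_sum _ fun t _ => ?_) (by positivity)
  simpa using Matrix.posSemidef_vecMulVec_self_star (S.fusedSample θ (t + 1) i)

namespace StandingAssumptions

/-- Every fused sample is orthogonal to the kernel of `R̃`, so the kernel condition of
`tendsto_pinv` holds for each realization, not only almost surely. -/
theorem stochasticEstimate_mulVec_eq_zero (hS : S.StandingAssumptions G)
    (θ : Fin N → ℕ → Fin n → ℝ) (k : ℕ) {i : Fin N} {x : Fin n → ℝ}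
    (hx : S.fusedR i *ᵥ x = 0) : S.stochasticEstimate θ k i *ᵥ x = 0 := by
  rw [stochasticEstimate_eq, Matrix.smul_mulVec, Matrix.sum_mulVec, Finset.sum_eq_zero, smul_zero]
  intro t _
  have h : S.fusedSample θ (t + 1) i ⬝ᵥ x = 0 := by
    rw [fusedSample, fuse_apply, sum_dotProduct]
    refine Finset.sum_eq_zero fun j _ => ?_
    rw [smul_dotProduct, Matrix.mulVec_transpose, ← Matrix.dotProduct_mulVec, ← dotProduct_smul,
      hS.weight_smul_mulVec_eq_zero hx, dotProduct_zero]
  rw [Matrix.vecMulVec_mulVec, h]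
  simp

/-- The stochastic estimate converges almost surely to the fused noise covariance. -/
theorem ae_tendsto_stochasticEstimate (hS : S.StandingAssumptions G)
    {Ω : Type*} [MeasurableSpace Ω] {ν : Measure Ω} [IsProbabilityMeasure ν]
    {θ : Fin N → ℕ → Ω → Fin n → ℝ} (hlaw : ∀ i k, 1 ≤ k → IsNormalVector (θ i k) 0 1 ν)
    (hindep : iIndepFun (fun p : Fin N × ℕ => θ p.1 (p.2 + 1)) ν) :
    ∀ᵐ ω ∂ν, ∀ i, Tendsto (fun k => S.stochasticEstimate (fun a k => θ a k ω) k i) atTop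
      (𝓝 (S.fusedR i)) := by
  have hae : ∀ᵐ ω ∂ν, ∀ (i j : Fin N) (c d : Fin n), Tendsto
      (fun k : ℕ => (∑ t ∈ Finset.range k, θ i (t + 1) ω c * θ j (t + 1) ω d) / k) atTop
      (𝓝 (if i = j ∧ c = d then 1 else 0)) := by
    simp only [ae_all_iff]
    exact ae_tendsto_average_mul hlaw hindep
  refine hae.mono fun ω hω i => ?_
  rw [Matrix.tendsto_iff_entries]
  intro a b
  -- Expanding both fused samples gives a finite combination of the scalar averages covered by the
  -- law of large numbers; in the limit only the terms with `p = p'` remain.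
  have h1 : ∀ k, S.stochasticEstimate (fun a k => θ a k ω) k i a b =
      ∑ p : Fin N × Fin n, ∑ p' : Fin N × Fin n,
        ((S.L ^ S.γ) i p.1 * S.Y p.1 p.2 a) * ((S.L ^ S.γ) i p'.1 * S.Y p'.1 p'.2 b) *
        ((∑ t ∈ Finset.range k, θ p.1 (t + 1) ω p.2 * θ p'.1 (t + 1) ω p'.2) / k) := by
    intro k
    rw [stochasticEstimate_eq, Matrix.smul_apply, Matrix.sum_apply, smul_eq_mul]
    simp only [Matrix.vecMulVec_apply, fusedSample_apply, Finset.sum_mul_sum]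
    rw [Finset.sum_comm, Finset.mul_sum]
    refine Finset.sum_congr rfl fun p _ => ?_
    rw [Finset.sum_comm, Finset.mul_sum]
    refine Finset.sum_congr rfl fun p' _ => ?_
    rw [div_eq_inv_mul, Finset.mul_sum, Finset.mul_sum, Finset.mul_sum]
    exact Finset.sum_congr rfl fun t _ => by ring
  have h2 : S.fusedR i a b = ∑ p : Fin N × Fin n, ∑ p' : Fin N × Fin n,
      ((S.L ^ S.γ) i p.1 * S.Y p.1 p.2 a) * ((S.L ^ S.γ) i p'.1 * S.Y p'.1 p'.2 b) *
        (if p.1 = p'.1 ∧ p.2 = p'.2 then 1 else 0) := by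
    rw [hS.fusedR_apply, ← Fintype.sum_prod_type']
    refine Finset.sum_congr rfl fun p _ => ?_
    simp only [← Prod.ext_iff, mul_ite, mul_one, mul_zero, Finset.sum_ite_eq, Finset.mem_univ,
      if_true]
    ring
  simp only [h1]
  rw [h2]
  exact tendsto_finsetSum _ fun p _ => tendsto_finsetSum _ fun p' _ =>
    (hω p.1 p'.1 p.2 p'.2).const_mul _

end StandingAssumptions

end SensorNetwork

end
theorem theorem2 {N n : ℕ} (S : SensorNetwork N n) (G : SimpleGraph (Fin N))
    (hS : S.StandingAssumptions G)
    {Ω : Type*} [MeasurableSpace Ω] (μ : Measure Ω) [IsProbabilityMeasure μ]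
    (x0 : Ω → Fin n → ℝ) (w : ℕ → Ω → Fin n → ℝ)
    (v : (i : Fin N) → ℕ → Ω → Fin (S.m i) → ℝ)
    (hnoise : S.NoiseModel μ x0 w v)
    {Ω₁ : Type*} [MeasurableSpace Ω₁] (ν₁ : Measure Ω₁) [IsProbabilityMeasure ν₁]
    (q : Fin N → Fin N → Ω₁ → ℝ)
    (hq_law : ∀ i j, HasLaw (q i j) (gaussianReal 0 1) ν₁)
    (hq_indep : iIndepFun (fun p : Fin N × Fin N => q p.1 p.2) ν₁)
    {Ω₂ : Type*} [MeasurableSpace Ω₂] (ν₂ : Measure Ω₂) [IsProbabilityMeasure ν₂]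
    (θ : Fin N → ℕ → Ω₂ → Fin n → ℝ)
    (hθ_law : ∀ i k, 1 ≤ k → IsNormalVector (θ i k) 0 1 ν₂)
    (hθ_indep : iIndepFun (fun p : Fin N × ℕ => θ p.1 (p.2 + 1)) ν₂)
    (hobs : ∀ i, Observable S.A (S.fusedC i)) :
    ∃ P : Fin N → Matrix (Fin n) (Fin n) ℝ,
      -- `P i` is the unique solution of the Riccati equation of node `i`
      (∀ i, S.SolvesDARE i (P i) ∧ ∀ P', S.SolvesDARE i P' → P' = P i) ∧
      -- the prior errors are square integrable, so that their covariances are genuine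
      (∀ U i k, MemLp (S.priorError x0 w v U i k) 2 μ) ∧
      -- direct method, for each full rank choice of the vectors `q i`
      (∀ q' : Fin N → Fin N → ℝ, (Matrix.of q').det ≠ 0 →
        ∀ i, Tendsto (S.truePriorCov x0 w v μ (S.directEstimate q') i) atTop (𝓝 (P i))) ∧
      -- direct method, with sampled vectors `q i`
      (∀ᵐ ω ∂ν₁, ∀ i,
        Tendsto (S.truePriorCov x0 w v μ (S.directEstimate fun a b => q a b ω) i)
          atTop (𝓝 (P i))) ∧
      -- stochastic method
      (∀ᵐ ω ∂ν₂, ∀ i,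
        Tendsto (S.truePriorCov x0 w v μ (S.stochasticEstimate fun a k => θ a k ω) i)
          atTop (𝓝 (P i))) := by

  -- `P i` attracts every run whose information matrices tend to `C̃ᵀ R̃† C̃`, so one `P` serves
  -- both methods and all samples.
  choose P hPsol hPuniq hPlim using fun i => exists_riccati_fixed (A := S.A) hS.Q_pos
    ((posSemidef_pinv (hS.fusedR_posSemidef i)).transpose_mul_mul (S.fusedC i))
    (hS.information_observable (hobs i))
  have hdirect : ∀ q' : Fin N → Fin N → ℝ, (Matrix.of q').det ≠ 0 → ∀ i,
      Tendsto (S.truePriorCov x0 w v μ (S.directEstimate q') i) atTop (𝓝 (P i)) :=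
    fun q' hq' i => SensorNetwork.tendsto_truePriorCov hS hnoise (hobs i) (hPlim i)
      (fun k => hS.directEstimate_posSemidef q' k i)
      (fun k _ hx => hS.directEstimate_mulVec_eq_zero q' k hx)
      (hS.tendsto_directEstimate hq' i)
  refine ⟨P, fun i => ⟨hPsol i, fun P' hP' => hPuniq i P' hP'.1 hP'.2⟩,
    fun U i k => hnoise.memLp_priorError U i k, hdirect, ?_, ?_⟩
  · exact (ae_det_ne_zero hq_law hq_indep).mono fun ω hω => hdirect _ hω
  · exact (hS.ae_tendsto_stochasticEstimate hθ_law hθ_indep).mono fun ω hω i =>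
      SensorNetwork.tendsto_truePriorCov hS hnoise (hobs i) (hPlim i)
        (fun k => SensorNetwork.stochasticEstimate_posSemidef _ k i)
        (fun k _ hx => hS.stochasticEstimate_mulVec_eq_zero _ k hx) (hω i)
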